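/- **Theorem (approximate reflection by quantum fast-forwarding).** *Setting.* Let $P$ be the transition matrix of an ergodic reversible Markov chain on a finite graph $G=(V,E)$ with $n=|V|\ge 2$ vertices (transitions only along edges of $G$ or from a vertex to itself). Let $1=\lambda_0\ge\lambda_1\ge\dots\ge\lambda_{n-1}$ be its eigenvalues, $\delta=1-\lambda_1$ its spectral gap, and $D(P)=\sqrt{P\circ P^{\mathsf T}}$ (entrywise) its discriminant. Let $|\psi_0\rangle,\dots,|\psi_{n-1}\rangle$ be any orthonormal basis of eigenvectors of $D(P)$, with eigenvalues in non-increasing order; $|\psi_0\rangle$ is the $1$-eigenvector. Let $|\bar 0\rangle$ be a fixed unit vector in $\Lambda_V=\mathrm{span}\{|x\rangle:x\in V\}$, let $U$ be any unitary on $\Lambda_V\otimes\Lambda_V$ with $U|x\rangle|\bar 0\rangle=|x\rangle\sum_y\sqrt{P_{xy}}\,|y\rangle$, let $S|x\rangle|y\rangle=|y\rangle|x\rangle$ if $(x,y)\in E$ and $S|x\rangle|y\rangle=|x\rangle|y\rangle$ otherwise, and let $R_{\bar 0}=I\otimes(2|\bar 0\rangle\langle\bar 0|-I)$. The quantum walk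 operator is $W=U^\dagger S U R_{\bar 0}$. The vertices are encoded as distinct basis states of $\lceil\log_2 n\rceil$ qubits, and $W$ is given as any unitary on $2\lceil\log_2 n\rceil$ qubits that acts as $W$ on the encoded $\Lambda_V\otimes\Lambda_V$. *Circuits.* A circuit acts on registers $R_1,R_2$ of $\lceil\log_2 n\rceil$ qubits each, $R_3$ of $\tau$ qubits and $R_4$ of one qubit. It is a sequence of unitary gates acting on $R_2R_3R_4$ and of calls to controlled-$W$ or controlled-$W^\dagger$ (control in $R_3$, target $R_1R_2$). For a unitary $V_q$ on $R_3$, let $$W_\tau=V_q^\dagger\Big(\sum_{l=0}^{2^\tau-1}W^l\otimes|l\rangle\langle l|\Big)V_q,\qquad \tilde R_\pi=ccX_{2,4}\,(W_\tau^\dagger\otimes I)\,ccZ_{23,4}\,(W_\tau\otimes I)\,ccX_{2,4},$$ where the middle factor of $W_\tau$ is implemented by calling controlled-$W$ $2^k$ times under control of the $k$-th qubit of $R_3$ for each $k<\tau$, $ccX_{2,4}$ applies $X$ to $R_4$ when $R_2$ is in state $|\bar 0\rangle$, and $ccZ_{23,4}$ applies $Z$ to $R_4$ when $R_2R_3$ is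 in state $|\bar 0\rangle|0^\tau\rangle$. *Statement.* There are absolute constants $c,C>0$ such that for all $\delta$ and all $\varepsilon_2\in(0,1)$ there are integers $\tau,t$ and a unitary $V_q$ on $\tau$ qubits, depending only on $\delta$ and $\varepsilon_2$, such that for every chain $P$ as above with spectral gap $\delta$ (and every $G$, $|\bar 0\rangle$, $U$, encoding and implementation of $W$ as above), $\delta>0$ and: 1. (Fast-forwarding.) $c\,\frac1\delta\log\frac4{\varepsilon_2}\le t\le C\,\frac1\delta\log\frac4{\varepsilon_2}$, and for every unit vector $|\psi\rangle\in\Lambda_V$, $$\big\|\Pi_{\bar 00}\,W_\tau|\psi\rangle|\bar 0\,0^\tau\rangle-\big(D(P^{\mathrm{lazy}})^t|\psi\rangle\big)|\bar 0\,0^\tau\rangle\big\|\le\varepsilon_2/4,$$ where $P^{\mathrm{lazy}}=(I+P)/2$ and $\Pi_{\bar 00}=I\otimes|\bar 0\rangle\langle\bar 0|\otimes|0^\tau\rangle\langle 0^\tau|$. 2. (Cost.) All gates of $\tilde R_\pi$ other than the calls are unitary, and the number of calls to controlled-$W^{\pm1}$ lies between $c\,\frac1{\sqrt\delta}\log\frac4{\varepsilon_2}$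 and $C\,\frac1{\sqrt\delta}\log\frac4{\varepsilon_2}$; the number of qubits is $2\lceil\log_2 n\rceil+a$ with $a$ between $c\,B$ and $C\,B$, where $B=\log\frac2{\sqrt\delta}+\log\log\frac4{\varepsilon_2}$. (Thus there are $\Theta(\delta^{-1/2}\log(1/\varepsilon_2))$ calls and $2\lceil\log n\rceil+\Theta(\log\delta^{-1/2}+\log\log(1/\varepsilon_2))$ qubits, the numbers $4$ and $2$ only keeping the logarithms away from $0$.) 3. (Action.) $|\psi_0\rangle$ has eigenvalue $1$ and $\|(\tilde R_\pi+I)|\psi_0\rangle|\bar 0\,0^\tau 0\rangle\|^2=0$, while $\|(\tilde R_\pi-I)|\psi_j\rangle|\bar 0\,0^\tau 0\rangle\|^2\le\varepsilon_2$ for $j=1,\dots,n-1$. -/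

import Mathlib

open scoped Matrix Kronecker

noncomputable section

/-! ## Markov chains -/

/-- `P` is the transition matrix of a Markov chain on the graph `G`: a row-stochastic matrix all of
whose transitions are along edges of `G` (staying put is always allowed). -/
structure IsMarkovChainOn {V : Type*} [Fintype V] (G : SimpleGraph V) (P : Matrix V V ℝ) :
    Prop where
  nonneg : ∀ x y, 0 ≤ P x y
  row_sum : ∀ x, ∑ y, P x y = 1
  edge : ∀ x y, x ≠ y → 0 < P x y → G.Adj x y

/-- Every state can reach every state, and the lengths of the directed closed walks have greatest
common divisor `1`. -/
structure IsErgodic {V : Type*} [Fintype V] [DecidableEq V] (P : Matrix V V ℝ) : Prop where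
  irreducible : ∀ x y, ∃ k : ℕ, 0 < (P ^ k) x y
  aperiodic : ∀ d : ℕ, (∀ (x : V) (k : ℕ), 0 < (P ^ k) x x → d ∣ k) → d = 1

/-- There is a stationary distribution that satisfies detailed balance. -/
def IsReversible {V : Type*} [Fintype V] (P : Matrix V V ℝ) : Prop :=
  ∃ p : V → ℝ, (∀ x, 0 ≤ p x) ∧ ∑ x, p x = 1 ∧ p ᵥ* P = p ∧ ∀ x y, p x * P x y = p y * P y x

/-- `1 - λ₁`, where `λ₀ ≥ λ₁ ≥ ⋯` are the real eigenvalues of `P`, repeated according to algebraic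
multiplicity. -/
def spectralGap {V : Type*} [Fintype V] [DecidableEq V] (P : Matrix V V ℝ) : ℝ :=
  1 - (P.charpoly.roots.sort (fun a b => a ≥ b)).getD 1 0

/-- The lazy chain `(I + P) / 2`. -/
def lazyChain {V : Type*} [DecidableEq V] (P : Matrix V V ℝ) : Matrix V V ℝ :=
  (1 / 2 : ℝ) • (1 + P)

/-- The discriminant matrix `D = √(P ∘ Pᵀ)` (entrywise), with complex entries. -/
def discriminant {V : Type*} (P : Matrix V V ℝ) : Matrix V V ℂ :=
  Matrix.of fun x y => ((√(P x y * P y x) : ℝ) : ℂ)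

/-- `ψ` is an orthonormal basis of eigenvectors of the discriminant of `P`, with the eigenvalues
`lam 0 ≥ lam 1 ≥ ⋯` in non-increasing order. -/
structure IsEigenbasis {V : Type*} [Fintype V] (P : Matrix V V ℝ)
    (ψ : OrthonormalBasis (Fin (Fintype.card V)) ℂ (EuclideanSpace ℂ V))
    (lam : Fin (Fintype.card V) → ℝ) : Prop where
  antitone : Antitone lam
  eigen : ∀ j, discriminant P *ᵥ (ψ j).ofLp = (lam j : ℂ) • (ψ j).ofLp

/-! ## States and the quantum walk operator -/

/-- The Euclidean (Hilbert space) norm of a vector of amplitudes. -/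
def stateNorm {ι : Type*} [Fintype ι] (v : ι → ℂ) : ℝ := ‖WithLp.toLp 2 v‖

/-- The tensor product of two vectors of amplitudes. -/
def tensor {α β : Type*} (u : α → ℂ) (v : β → ℂ) : α × β → ℂ := fun p => u p.1 * v p.2

/-- The rank-one operator `|v⟩⟨v|`. -/
def rankOne {α : Type*} (v : α → ℂ) : Matrix α α ℂ := Matrix.vecMulVec v (star v)

/-- `U` is a unitary on `Λ_V ⊗ Λ_V` with `U |x⟩|0̄⟩ = |x⟩ ∑_y √(P x y) |y⟩`; `z` is `|0̄⟩`. -/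
structure IsStatePreparation {V : Type*} [Fintype V] [DecidableEq V] (P : Matrix V V ℝ)
    (z : V → ℂ) (U : Matrix (V × V) (V × V) ℂ) : Prop where
  unitary : U ∈ Matrix.unitaryGroup (V × V) ℂ
  apply : ∀ x : V, U *ᵥ tensor (Pi.single x 1) z
    = tensor (Pi.single x 1) (fun y => ((√(P x y) : ℝ) : ℂ))

open Classical in
/-- The shift: `|x⟩|y⟩ ↦ |y⟩|x⟩` if `xy` is an edge, `|x⟩|y⟩ ↦ |x⟩|y⟩` otherwise. (Whether loops
count as edges does not matter, because `|x⟩|x⟩` is fixed in either case.) -/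
def shiftOperator {V : Type*} (G : SimpleGraph V) : Matrix (V × V) (V × V) ℂ :=
  Matrix.of fun q p => if q = (if G.Adj p.1 p.2 then p.swap else p) then 1 else 0

/-- The reflection `R_0̄ = I ⊗ (2 |0̄⟩⟨0̄| - I)`. -/
def zeroReflection {V : Type*} [DecidableEq V] (z : V → ℂ) : Matrix (V × V) (V × V) ℂ :=
  (1 : Matrix V V ℂ) ⊗ₖ ((2 : ℂ) • rankOne z - 1)

/-- The quantum walk operator `W = U† · S · U · R_0̄`. -/
def walkOperator {V : Type*} [Fintype V] [DecidableEq V] (G : SimpleGraph V) (z : V → ℂ)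
    (U : Matrix (V × V) (V × V) ℂ) : Matrix (V × V) (V × V) ℂ :=
  Uᴴ * shiftOperator G * U * zeroReflection z

/-! ## Encoding into qubits -/

/-- The computational basis labels of `m` qubits. -/
abbrev Bits (m : ℕ) := Fin m → Bool

/-- The isometry `|x⟩ ↦ |enc x⟩`. -/
def encodeOne {V : Type*} {m : ℕ} (enc : V ↪ Bits m) : Matrix (Bits m) V ℂ :=
  Matrix.of fun b x => if b = enc x then 1 else 0

/-- The isometry `|x⟩|y⟩ ↦ |enc x⟩|enc y⟩`. -/
def encodeTwo {V : Type*} {m : ℕ} (enc : V ↪ Bits m) : Matrix (Bits m × Bits m) (V × V) ℂ :=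
  encodeOne enc ⊗ₖ encodeOne enc

/-- `Wq` is a unitary on two registers of `m` qubits that acts as `W` on the encoded copy of
`Λ_V ⊗ Λ_V`. (What it does on the orthogonal complement is left open.) -/
structure Implements {V : Type*} [Fintype V] [DecidableEq V] {m : ℕ} (enc : V ↪ Bits m)
    (W : Matrix (V × V) (V × V) ℂ) (Wq : Matrix (Bits m × Bits m) (Bits m × Bits m) ℂ) :
    Prop where
  unitary : Wq ∈ Matrix.unitaryGroup (Bits m × Bits m) ℂ
  intertwines : Wq * encodeTwo enc = encodeTwo enc * W

/-! ## Quantum circuits with calls to the controlled walk operator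

There are four registers `R₁ R₂ R₃ R₄` of `m`, `m`, `τ` and `1` qubits. -/

/-- The computational basis labels of the four registers. -/
abbrev Basis (m τ : ℕ) := Bits m × Bits m × Bits τ × Bool

/-- A gate is either an explicitly given operator on `R₂ R₃ R₄`, or a call to controlled-`W`
(controlled-`W†` if `inv = true`), controlled by a qubit of `R₃`, with `W` acting on `R₁ R₂`. -/
inductive Gate (m τ : ℕ) : Type
  | loc (U : Matrix (Bits m × Bits τ × Bool) (Bits m × Bits τ × Bool) ℂ) : Gate m τ
  | call (k : Fin τ) (inv : Bool) : Gate m τ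

namespace Gate

/-- The explicitly given gates have to be unitary. -/
def IsUnitary {m τ : ℕ} : Gate m τ → Prop
  | loc U => U ∈ Matrix.unitaryGroup (Bits m × Bits τ × Bool) ℂ
  | call _ _ => True

def adj {m τ : ℕ} : Gate m τ → Gate m τ
  | loc U => loc Uᴴ
  | call k inv => call k (!inv)

/-- The number of calls to controlled-`W` or controlled-`W†`. -/
def calls {m τ : ℕ} : Gate m τ → ℕ
  | loc _ => 0
  | call _ _ => 1

/-- The operator of a gate, for the walk operator `W`. -/
def eval {m τ : ℕ} (W : Matrix (Bits m × Bits m) (Bits m × Bits m) ℂ) :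
    Gate m τ → Matrix (Basis m τ) (Basis m τ) ℂ
  | loc U => (1 : Matrix (Bits m) (Bits m) ℂ) ⊗ₖ U
  | call k inv => Matrix.of fun p q =>
      if p.2.2 = q.2.2 then
        (if q.2.2.1 k then (if inv then Wᴴ else W) else 1) (p.1, p.2.1) (q.1, q.2.1)
      else 0

end Gate

/-- A circuit is a list of gates, the first gate of the list being applied first. -/
abbrev Circuit (m τ : ℕ) := List (Gate m τ)

namespace Circuit

def eval {m τ : ℕ} (W : Matrix (Bits m × Bits m) (Bits m × Bits m) ℂ) :
    Circuit m τ → Matrix (Basis m τ) (Basis m τ) ℂ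
  | [] => 1
  | g :: C => eval W C * g.eval W

def adj {m τ : ℕ} (C : Circuit m τ) : Circuit m τ := (C.map Gate.adj).reverse

def calls {m τ : ℕ} (C : Circuit m τ) : ℕ := (C.map Gate.calls).sum

/-- The number of qubits of the four registers. -/
def numQubits {m τ : ℕ} (_ : Circuit m τ) : ℕ := m + m + τ + 1

end Circuit

/-! ## The fast-forwarding circuit and the approximate reflection -/

/-- The basis state `|0^τ⟩`. -/
def zeroKet (τ : ℕ) : Bits τ → ℂ := Pi.single (fun _ => false) 1

/-- The state `v ⊗ |0̄⟩ ⊗ |0^τ⟩ ⊗ |0⟩` of the four registers, for `v` and `|0̄⟩ = z` in `Λ_V`. -/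
def inputState {V : Type*} [Fintype V] {m : ℕ} (τ : ℕ) (enc : V ↪ Bits m) (z v : V → ℂ) :
    Basis m τ → ℂ :=
  tensor (encodeOne enc *ᵥ v)
    (tensor (encodeOne enc *ᵥ z) (tensor (zeroKet τ) (Pi.single false 1)))

/-- The projection `Π_{0̄0} = I ⊗ |0̄⟩⟨0̄| ⊗ |0^τ⟩⟨0^τ| ⊗ I`; `z` is `|0̄⟩` as a state of `R₂`. -/
def zeroProjection {m : ℕ} (τ : ℕ) (z : Bits m → ℂ) : Matrix (Basis m τ) (Basis m τ) ℂ :=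
  (1 : Matrix (Bits m) (Bits m) ℂ) ⊗ₖ
    (rankOne z ⊗ₖ (rankOne (zeroKet τ) ⊗ₖ (1 : Matrix Bool Bool ℂ)))

def pauliX : Matrix Bool Bool ℂ := Matrix.of fun a b => if a = !b then 1 else 0

def pauliZ : Matrix Bool Bool ℂ := Matrix.diagonal fun b => if b then -1 else 1

/-- `V_q` on `R₃`. -/
def gateOnThree {m τ : ℕ} (Vq : Matrix (Bits τ) (Bits τ) ℂ) : Gate m τ :=
  Gate.loc ((1 : Matrix (Bits m) (Bits m) ℂ) ⊗ₖ (Vq ⊗ₖ (1 : Matrix Bool Bool ℂ)))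

/-- Pauli `X` on `R₄`, applied when `R₂` is in the state `|0̄⟩ = z`. -/
def ccX {m : ℕ} (τ : ℕ) (z : Bits m → ℂ) : Gate m τ :=
  Gate.loc (rankOne z ⊗ₖ ((1 : Matrix (Bits τ) (Bits τ) ℂ) ⊗ₖ pauliX)
    + (1 - rankOne z) ⊗ₖ (1 : Matrix (Bits τ × Bool) (Bits τ × Bool) ℂ))

/-- Pauli `Z` on `R₄`, applied when `R₂ R₃` is in the state `|0̄⟩|0^τ⟩`, where `|0̄⟩ = z`. -/
def ccZ {m : ℕ} (τ : ℕ) (z : Bits m → ℂ) : Gate m τ :=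
  Gate.loc (rankOne z ⊗ₖ (rankOne (zeroKet τ) ⊗ₖ pauliZ)
    + (1 - rankOne z ⊗ₖ (rankOne (zeroKet τ) ⊗ₖ (1 : Matrix Bool Bool ℂ))))

/-- `W_ctrl = ∑_{l < 2^τ} W^l ⊗ |l⟩⟨l|`: for each `k < τ`, the operator `W` is called `2^k` times,
controlled by the `k`-th qubit of `R₃`. -/
def ctrlPowers (m τ : ℕ) : Circuit m τ :=
  (List.finRange τ).flatMap fun k : Fin τ => List.replicate (2 ^ (k : ℕ)) (Gate.call k false)

/-- The fast-forwarding circuit `W_τ = V_q† W_ctrl V_q`. -/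
def fastForward (m : ℕ) {τ : ℕ} (Vq : Matrix (Bits τ) (Bits τ) ℂ) : Circuit m τ :=
  [gateOnThree Vq] ++ ctrlPowers m τ ++ [gateOnThree Vqᴴ]

/-- The circuit `R̃_π = ccX · W_τ† · ccZ · W_τ · ccX`. -/
def reflectionCircuit {m τ : ℕ} (z : Bits m → ℂ) (Vq : Matrix (Bits τ) (Bits τ) ℂ) :
    Circuit m τ :=
  [ccX τ z] ++ fastForward m Vq ++ [ccZ τ z] ++ Circuit.adj (fastForward m Vq) ++ [ccX τ z]

end

/-!
Why the circuit works.

*Linear combination of unitaries.* Let `K : u ↦ u ⊗ |0̄⟩` (`tensorRight`) and `A = U† S U`. Then `A` is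
an involution, the walk operator is `W = A (2 K K† - 1)`, and detailed balance plays no role in
`K† A K = D` (`compression_shift_eq_discriminant`). Because `W⁻¹ = (2 K K† - 1) A`, one has
`K† (W + W⁻¹) = 2 D K†`, which is the Chebyshev recursion, so `K† W^l K = T_l(D)`
(`compression_walk_pow`). If `V_q |0^τ⟩ = ∑ √q_l |l⟩`, the block of `W_τ` selected by `|0̄⟩|0^τ⟩` is
therefore `∑ q_l T_l(D)` (`zeroProjection_fastForward_mulVec`).

*Fast-forwarding.* The discriminant of the lazy chain is `(1 + D) / 2`, and its `t`-th power is
`∑_k 4^(-t) (2t choose k) T_|k-t|(D)` (`aeval_T_expansion`). The weights form a centred binomial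
distribution of variance `t / 2`, so by Hoeffding's inequality degrees beyond a multiple of
`√(t log (1/ε))` carry little weight (`sum_binomialWeight_tail_le`). Their terms are replaced by
`T_0`; as every `T_l(D)` is a contraction, the error is at most twice the weight of the tail. Moving
that weight to degree `0` keeps `q` a probability distribution, so `√q` is a unit vector and extends
to a unitary `V_q` (`exists_unitary_degreeWeight`).

*Reflection.* With `R₄` flipped to `|1⟩`, the controlled `Z` is `1 - 2 Π`, so the circuit acts as
`1 - 2 X W_τ† Π W_τ X` (`eval_reflectionCircuit_mulVec`). On an eigenvector with eigenvalue at most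
`1 - δ`, the block `Π W_τ` is small because `(1 - δ/2)^t` is. On the eigenvector with eigenvalue `1`
all `T_l(D)` are the identity, so `Π W_τ` preserves the norm, hence `W_τ` fixes the state and the
reflection is exact (`reflection_add_one_mulVec_of_fixed`).

*Spectrum.* For a reversing measure `r²` the discriminant is `diag(r) P diag(r)⁻¹`, so it has the
characteristic polynomial of `P` (`charpoly_discriminant`). It is a contraction, being a compression
of a unitary, and the eigenvalue `1` is simple by irreducibility
(`exists_eq_smul_sqrt_of_discriminant_mulVec_eq`). Hence `0 < δ ≤ 2`, and for the remaining values
of `δ` there is nothing to prove.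
-/

noncomputable section

/-! ### The norm of amplitude vectors -/

section StateNorm

variable {ι κ : Type*} [Fintype ι] [Fintype κ]

theorem stateNorm_sq (v : ι → ℂ) : stateNorm v ^ 2 = ∑ i, ‖v i‖ ^ 2 := by
  simp [stateNorm, EuclideanSpace.norm_sq_eq]

theorem stateNorm_nonneg (v : ι → ℂ) : 0 ≤ stateNorm v := norm_nonneg _

theorem stateNorm_sq_eq_dotProduct (v : ι → ℂ) : ((stateNorm v ^ 2 : ℝ) : ℂ) = star v ⬝ᵥ v := by
  rw [stateNorm_sq, dotProduct]
  push_cast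
  exact Finset.sum_congr rfl fun i _ => by simp [← Complex.conj_mul']

theorem stateNorm_zero : stateNorm (0 : ι → ℂ) = 0 := by simp [stateNorm]

theorem eq_zero_of_stateNorm_eq_zero {v : ι → ℂ} (h : stateNorm v = 0) : v = 0 := by
  simpa [stateNorm] using h

theorem stateNorm_add_le (v w : ι → ℂ) : stateNorm (v + w) ≤ stateNorm v + stateNorm w := by
  simpa [stateNorm] using norm_add_le (WithLp.toLp 2 v) (WithLp.toLp 2 w)

theorem stateNorm_sub_le (v w : ι → ℂ) : stateNorm (v - w) ≤ stateNorm v + stateNorm w := by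
  simpa [stateNorm] using norm_sub_le (WithLp.toLp 2 v) (WithLp.toLp 2 w)

theorem stateNorm_smul (c : ℂ) (v : ι → ℂ) : stateNorm (c • v) = ‖c‖ * stateNorm v := by
  simpa [stateNorm] using norm_smul c (WithLp.toLp 2 v)

theorem stateNorm_neg (v : ι → ℂ) : stateNorm (-v) = stateNorm v := by simp [stateNorm]

theorem stateNorm_sum_le {α : Type*} (s : Finset α) (f : α → ι → ℂ) :
    stateNorm (∑ a ∈ s, f a) ≤ ∑ a ∈ s, stateNorm (f a) := by
  simpa [stateNorm, WithLp.toLp_sum] using norm_sum_le s fun a => WithLp.toLp 2 (f a)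

theorem stateNorm_mulVec_of_isometry [DecidableEq κ] {A : Matrix ι κ ℂ} (hA : Aᴴ * A = 1)
    (v : κ → ℂ) : stateNorm (A *ᵥ v) = stateNorm v := by
  have h : stateNorm (A *ᵥ v) ^ 2 = stateNorm v ^ 2 := by
    rw [← Complex.ofReal_inj, stateNorm_sq_eq_dotProduct, stateNorm_sq_eq_dotProduct,
      Matrix.star_mulVec, Matrix.dotProduct_mulVec, Matrix.vecMul_vecMul, hA, Matrix.vecMul_one]
  exact (sq_eq_sq₀ (stateNorm_nonneg _) (stateNorm_nonneg _)).1 h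

theorem conjTranspose_mul_self_of_mem_unitaryGroup [DecidableEq ι] {A : Matrix ι ι ℂ}
    (hA : A ∈ Matrix.unitaryGroup ι ℂ) : Aᴴ * A = 1 := Matrix.mem_unitaryGroup_iff'.1 hA

theorem self_mul_conjTranspose_of_mem_unitaryGroup [DecidableEq ι] {A : Matrix ι ι ℂ}
    (hA : A ∈ Matrix.unitaryGroup ι ℂ) : A * Aᴴ = 1 := Matrix.mem_unitaryGroup_iff.1 hA

theorem stateNorm_mulVec_of_unitary [DecidableEq ι] {A : Matrix ι ι ℂ}
    (hA : A ∈ Matrix.unitaryGroup ι ℂ) (v : ι → ℂ) : stateNorm (A *ᵥ v) = stateNorm v :=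
  stateNorm_mulVec_of_isometry (conjTranspose_mul_self_of_mem_unitaryGroup hA) v

theorem stateNorm_tensor (u : ι → ℂ) (v : κ → ℂ) :
    stateNorm (tensor u v) = stateNorm u * stateNorm v := by
  have h : stateNorm (tensor u v) ^ 2 = (stateNorm u * stateNorm v) ^ 2 := by
    rw [mul_pow, stateNorm_sq, stateNorm_sq, stateNorm_sq, Fintype.sum_prod_type,
      Finset.sum_mul_sum]
    simp [tensor, mul_pow]
  exact (sq_eq_sq₀ (stateNorm_nonneg _)
    (mul_nonneg (stateNorm_nonneg _) (stateNorm_nonneg _))).1 h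

theorem stateNorm_single [DecidableEq ι] (i : ι) : stateNorm (Pi.single i (1 : ℂ)) = 1 := by
  simp [stateNorm]

theorem stateNorm_orthonormalBasis (ψ : OrthonormalBasis κ ℂ (EuclideanSpace ℂ ι)) (j : κ) :
    stateNorm (ψ j).ofLp = 1 := ψ.orthonormal.1 j

/-- If a projection `Q` fixes `v` and also recovers `v` from `A v`, with `A` unitary, then `A v` has
no component outside the range of `Q`, because its norm is already exhausted. -/
theorem unitary_mulVec_eq_self_of_projection [DecidableEq ι] {A Q : Matrix ι ι ℂ}
    (hA : A ∈ Matrix.unitaryGroup ι ℂ) (hQ : Qᴴ = Q) {v : ι → ℂ} (hv : Q *ᵥ v = v)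
    (hAv : Q *ᵥ (A *ᵥ v) = v) : A *ᵥ v = v := by
  have h1 : star v ⬝ᵥ (A *ᵥ v) = star v ⬝ᵥ v := by
    nth_rewrite 1 [← hv]
    rw [Matrix.star_mulVec, hQ, ← Matrix.dotProduct_mulVec, hAv]
  have h2 : star (A *ᵥ v) ⬝ᵥ v = star v ⬝ᵥ v := by
    have := congrArg star h1
    rwa [← Matrix.star_dotProduct, ← Matrix.star_dotProduct] at this
  have h3 : star (A *ᵥ v) ⬝ᵥ (A *ᵥ v) = star v ⬝ᵥ v := by
    rw [← stateNorm_sq_eq_dotProduct, stateNorm_mulVec_of_unitary hA, stateNorm_sq_eq_dotProduct]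
  have h4 : ((stateNorm (A *ᵥ v - v) ^ 2 : ℝ) : ℂ) = 0 := by
    rw [stateNorm_sq_eq_dotProduct, star_sub, sub_dotProduct, dotProduct_sub, dotProduct_sub, h1,
      h2, h3]
    simp
  have h5 : stateNorm (A *ᵥ v - v) = 0 := by
    have := Complex.ofReal_eq_zero.1 h4
    exact pow_eq_zero_iff two_ne_zero |>.1 this
  exact sub_eq_zero.1 (eq_zero_of_stateNorm_eq_zero h5)

/-- Every unit vector is a column of a unitary matrix. -/
theorem exists_unitary_mulVec_single [DecidableEq ι] (i : ι) {u : ι → ℂ} (hu : stateNorm u = 1) :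
    ∃ A ∈ Matrix.unitaryGroup ι ℂ, A *ᵥ Pi.single i 1 = u := by
  have hon : Orthonormal ℂ (Set.domRestrict {i} fun _ : ι => WithLp.toLp 2 u) := by
    refine ⟨fun _ => hu, fun a b hab => ?_⟩
    exact absurd (Subsingleton.elim a b) hab
  obtain ⟨b, hb⟩ := hon.exists_orthonormalBasis_extension_of_card_eq (by simp)
  refine ⟨(EuclideanSpace.basisFun ι ℂ).toBasis.toMatrix b,
    (EuclideanSpace.basisFun ι ℂ).toMatrix_orthonormalBasis_mem_unitary b, ?_⟩
  ext j
  simp [Module.Basis.toMatrix_apply, hb i rfl]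

end StateNorm

/-! ### Powers as averages of Chebyshev polynomials -/

section Chebyshev

open Polynomial

/-- Pascal's rule for a binomially weighted window of a sequence. -/
theorem sum_choose_succ {M : Type*} [Semiring M] (f : ℕ → M) (s : ℕ) :
    ∑ k ∈ Finset.range (s + 2), ((s + 1).choose k : M) * f k
      = ∑ k ∈ Finset.range (s + 1), (s.choose k : M) * f k
        + ∑ k ∈ Finset.range (s + 1), (s.choose k : M) * f (k + 1) := by
  rw [Finset.sum_range_succ' _ (s + 1)]
  simp only [Nat.choose_succ_succ, Nat.cast_add, add_mul, Finset.sum_add_distrib]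
  rw [Finset.sum_range_succ (fun k => (s.choose (k + 1) : M) * f (k + 1)) s,
    Finset.sum_range_succ' (fun k => (s.choose k : M) * f k) s]
  simp
  abel

/-- Since `T_{n+1} + 2 T_n + T_{n-1} = (2 + 2X) T_n`, multiplying by `2 + 2X` is two steps of
Pascal's rule. -/
theorem sum_choose_mul_T (R : Type*) [CommRing R] (t : ℕ) (n : ℤ) :
    ∑ k ∈ Finset.range (2 * t + 1), ((2 * t).choose k : R[X]) * Chebyshev.T R (n + k)
      = (2 + 2 * X) ^ t * Chebyshev.T R (n + t) := by
  induction t generalizing n with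
  | zero => simp
  | succ t ih =>
    have h1 := sum_choose_succ (fun k : ℕ => Chebyshev.T R (n + k)) (2 * t + 1)
    have h2 := sum_choose_succ (fun k : ℕ => Chebyshev.T R (n + k)) (2 * t)
    have h3 := sum_choose_succ (fun k : ℕ => Chebyshev.T R (n + (k + 1 : ℕ))) (2 * t)
    have e1 (k : ℕ) : n + ((k + 1 : ℕ) : ℤ) = n + 1 + k := by push_cast; ring
    have e2 (k : ℕ) : n + ((k + 1 + 1 : ℕ) : ℤ) = n + 2 + k := by push_cast; ring
    simp only [e2] at h3
    simp only [e1] at h1 h2 h3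
    rw [ih] at h2 h3
    rw [ih] at h2 h3
    rw [show 2 * (t + 1) = 2 * t + 1 + 1 by ring, h1, h2, h3]
    have h4 := Chebyshev.T_add_two R (n + t)
    rw [show n + 1 + (t : ℤ) = n + t + 1 by ring, show n + 2 + (t : ℤ) = n + t + 2 by ring, h4,
      show n + ((t + 1 : ℕ) : ℤ) = n + t + 1 by push_cast; ring]
    ring

/-- The probability that `2t` fair coins show `k` heads. -/
def binomialWeight (t k : ℕ) : ℝ := ((2 * t).choose k : ℝ) / 4 ^ t

theorem binomialWeight_nonneg (t k : ℕ) : 0 ≤ binomialWeight t k := by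
  unfold binomialWeight; positivity

theorem sum_binomialWeight (t : ℕ) :
    ∑ k ∈ Finset.range (2 * t + 1), binomialWeight t k = 1 := by
  simp only [binomialWeight, ← Finset.sum_div]
  rw [← Nat.cast_sum, Nat.sum_range_choose, pow_mul]
  norm_num

theorem aeval_T_expansion {A : Type*} [Ring A] [Algebra ℂ A] (x : A) (t : ℕ) :
    ((1 / 2 : ℂ) • (1 + x)) ^ t
      = ∑ k ∈ Finset.range (2 * t + 1),
          (binomialWeight t k : ℂ) • aeval x (Chebyshev.T ℂ ((k : ℤ) - t)) := by
  have h := congrArg (aeval x) (sum_choose_mul_T ℂ t (-(t : ℤ)))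
  have e : (aeval x) (2 + 2 * X : ℂ[X]) = (4 : ℂ) • ((1 / 2 : ℂ) • (1 + x)) := by
    rw [smul_smul, map_add, map_mul, aeval_X, ← mul_one_add]
    rw [Algebra.smul_def]
    norm_num
    rw [map_ofNat, map_ofNat]
  rw [neg_add_cancel, Chebyshev.T_zero, mul_one, map_pow, e, _root_.smul_pow, map_sum] at h
  have h4 : (4 : ℂ) ^ t ≠ 0 := pow_ne_zero _ (by norm_num)
  rw [← inv_smul_eq_iff₀ h4] at h
  rw [← h, Finset.smul_sum]
  refine Finset.sum_congr rfl fun k _ => ?_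
  rw [binomialWeight, map_mul, map_natCast, neg_add_eq_sub, ← nsmul_eq_mul,
    ← Nat.cast_smul_eq_nsmul ℂ, smul_smul]
  congr 1
  push_cast
  field_simp

/-- The moment generating function of the centred binomial distribution. -/
theorem sum_binomialWeight_mul_exp (t : ℕ) (s : ℝ) :
    ∑ k ∈ Finset.range (2 * t + 1), binomialWeight t k * Real.exp (s * ((k : ℝ) - t))
      = Real.cosh (s / 2) ^ (2 * t) := by
  have h := add_pow (Real.exp (s / 2)) (Real.exp (-(s / 2))) (2 * t)
  rw [Real.cosh_eq, div_pow, h, pow_mul, Finset.sum_div]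
  refine Finset.sum_congr rfl fun k hk => ?_
  have hk' : k ≤ 2 * t := Nat.lt_succ_iff.1 (Finset.mem_range.1 hk)
  rw [binomialWeight, ← Real.exp_nat_mul, ← Real.exp_nat_mul, ← Real.exp_add, Nat.cast_sub hk',
    show s * ((k : ℝ) - t) = k * (s / 2) + ((2 * t : ℕ) - k) * -(s / 2) by push_cast; ring]
  norm_num
  ring

/-- Hoeffding's inequality for `2t` fair coins. -/
theorem sum_binomialWeight_tail_le {t : ℕ} (ht : 0 < t) {N : ℝ} (hN : 0 ≤ N) :
    ∑ k ∈ Finset.range (2 * t + 1) with N ≤ |((k : ℕ) : ℝ) - t|, binomialWeight t k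
      ≤ 2 * Real.exp (-(N ^ 2 / t)) := by
  have ht' : (0 : ℝ) < t := by exact_mod_cast ht
  -- the optimal exponent in Chernoff's bound
  set s : ℝ := 2 * N / t with hs
  have hs0 : 0 ≤ s := by positivity
  have hcosh : Real.cosh (s / 2) ^ (2 * t) ≤ Real.exp (N ^ 2 / t) := by
    calc Real.cosh (s / 2) ^ (2 * t) ≤ Real.exp ((s / 2) ^ 2 / 2) ^ (2 * t) := by
          gcongr
          exact Real.cosh_le_exp_half_sq _
      _ = Real.exp (N ^ 2 / t) := by
          rw [← Real.exp_nat_mul]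
          congr 1
          rw [hs]; push_cast; field_simp
  calc ∑ k ∈ Finset.range (2 * t + 1) with N ≤ |((k : ℕ) : ℝ) - t|, binomialWeight t k
      ≤ ∑ k ∈ Finset.range (2 * t + 1) with N ≤ |((k : ℕ) : ℝ) - t|,
          binomialWeight t k * (Real.exp (-(s * N)) *
            (Real.exp (s * ((k : ℝ) - t)) + Real.exp (-s * ((k : ℝ) - t)))) := by
        refine Finset.sum_le_sum fun k hk => le_mul_of_one_le_right (binomialWeight_nonneg _ _) ?_
        have hk' := (Finset.mem_filter.1 hk).2
        rw [mul_add, ← Real.exp_add, ← Real.exp_add]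
        rcases le_abs.1 hk' with h | h
        · have : 1 ≤ Real.exp (-(s * N) + s * ((k : ℝ) - t)) := Real.one_le_exp (by nlinarith)
          linarith [Real.exp_pos (-(s * N) + -s * ((k : ℝ) - t))]
        · have : 1 ≤ Real.exp (-(s * N) + -s * ((k : ℝ) - t)) := Real.one_le_exp (by nlinarith)
          linarith [Real.exp_pos (-(s * N) + s * ((k : ℝ) - t))]
    _ ≤ ∑ k ∈ Finset.range (2 * t + 1),
          binomialWeight t k * (Real.exp (-(s * N)) *
            (Real.exp (s * ((k : ℝ) - t)) + Real.exp (-s * ((k : ℝ) - t)))) := by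
        refine Finset.sum_le_sum_of_subset_of_nonneg (Finset.filter_subset _ _) fun k _ _ => ?_
        have := binomialWeight_nonneg t k
        positivity
    _ = Real.exp (-(s * N)) * (2 * Real.cosh (s / 2) ^ (2 * t)) := by
        have h1 := sum_binomialWeight_mul_exp t s
        have h2 := sum_binomialWeight_mul_exp t (-s)
        rw [neg_div, Real.cosh_neg] at h2
        rw [two_mul (Real.cosh (s / 2) ^ (2 * t))]
        nth_rewrite 1 [← h1]
        rw [← h2, ← Finset.sum_add_distrib, Finset.mul_sum]
        exact Finset.sum_congr rfl fun k _ => by ring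
    _ ≤ Real.exp (-(s * N)) * (2 * Real.exp (N ^ 2 / t)) := by gcongr
    _ = 2 * Real.exp (-(N ^ 2 / t)) := by
        rw [mul_left_comm, ← Real.exp_add]
        congr 2
        rw [hs]; field_simp; ring

end Chebyshev

/-! ### Powers of the walk operator compressed to `|0̄⟩` -/

section Walk

open Polynomial

/-- The map `u ↦ u ⊗ z`. For a unit vector `z` it is an isometry, and its adjoint is the partial
inner product with `z`. -/
def tensorRight (α : Type*) {β : Type*} [DecidableEq α] (z : β → ℂ) : Matrix (α × β) α ℂ :=
  Matrix.of fun p x => if p.1 = x then z p.2 else 0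

section TensorRight

variable {α β : Type*} [Fintype α] [DecidableEq α]

theorem tensorRight_mulVec (z : β → ℂ) (u : α → ℂ) : tensorRight α z *ᵥ u = tensor u z := by
  ext p
  simp [tensorRight, tensor, Matrix.mulVec, dotProduct, mul_comm]

variable [Fintype β]

theorem tensorRight_conjTranspose_mulVec (z : β → ℂ) (w : α × β → ℂ) (x : α) :
    ((tensorRight α z)ᴴ *ᵥ w) x = ∑ y, star (z y) * w (x, y) := by
  simp [tensorRight, Matrix.mulVec, dotProduct, Fintype.sum_prod_type, apply_ite, ite_mul]

theorem tensorRight_isometry {z : β → ℂ} (hz : stateNorm z = 1) :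
    (tensorRight α z)ᴴ * tensorRight α z = 1 := by
  have h : ∑ y, (starRingEnd ℂ) (z y) * z y = 1 := by
    have := stateNorm_sq_eq_dotProduct z
    rw [hz] at this
    simpa [dotProduct] using this.symm
  ext x x'
  rw [Matrix.mul_apply, Fintype.sum_prod_type]
  by_cases hx : x = x'
  · subst hx
    simp [tensorRight, apply_ite, h]
  · simp [tensorRight, apply_ite, Matrix.one_apply_ne hx, Ne.symm hx]

end TensorRight

section Compression

variable {ι κ : Type*} [Fintype ι] [Fintype κ] [DecidableEq ι] [DecidableEq κ]

/-- Let `K` be an isometry and `A` an involution. The compressions of the powers of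
`A (2 K Kᴴ - 1)` to the range of `K` are the Chebyshev polynomials of the compression of `A`. -/
theorem compression_pow_eq_aeval_T {K : Matrix ι κ ℂ} {A : Matrix ι ι ℂ} (hK : Kᴴ * K = 1)
    (hA : A * A = 1) (l : ℕ) :
    Kᴴ * (A * ((2 : ℂ) • (K * Kᴴ) - 1)) ^ l * K = aeval (Kᴴ * A * K) (Chebyshev.T ℂ (l : ℤ)) := by
  set R : Matrix ι ι ℂ := (2 : ℂ) • (K * Kᴴ) - 1 with hR
  have hKR : Kᴴ * R = Kᴴ := by
    rw [hR, Matrix.mul_sub, Matrix.mul_smul, ← Matrix.mul_assoc, hK, Matrix.one_mul, Matrix.mul_one,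
      two_smul, add_sub_cancel_right]
  have hRK : R * K = K := by
    rw [hR, Matrix.sub_mul, Matrix.smul_mul, Matrix.mul_assoc, hK, Matrix.one_mul, Matrix.mul_one,
      two_smul, add_sub_cancel_right]
  have hRR : R * R = 1 := by
    nth_rewrite 2 [hR]
    rw [Matrix.mul_sub, Matrix.mul_smul, ← Matrix.mul_assoc, hRK, mul_one, hR]
    abel
  have hinv : R * A * (A * R) = 1 := by
    rw [Matrix.mul_assoc, ← Matrix.mul_assoc A, hA, Matrix.one_mul, hRR]
  -- `R A` is the inverse of the walk `A R`, and `Kᴴ (A R + R A) = 2 (Kᴴ A K) Kᴴ`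
  have hsum : Kᴴ * (A * R) + Kᴴ * (R * A) = (2 : ℂ) • (Kᴴ * A * K * Kᴴ) := by
    rw [← Matrix.mul_assoc Kᴴ R, hKR, hR]
    simp only [Matrix.mul_sub, Matrix.mul_smul, Matrix.mul_assoc, Matrix.mul_one]
    abel
  induction l using Nat.strong_induction_on with
  | _ l ih =>
    match l with
    | 0 => simp [hK]
    | 1 =>
      simp only [pow_one, Nat.cast_one, Chebyshev.T_one, aeval_X]
      rw [Matrix.mul_assoc, Matrix.mul_assoc A, hRK, Matrix.mul_assoc]
    | l + 2 =>
      have h0 := ih l (by omega)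
      have h1 := ih (l + 1) (by omega)
      have hstep : Kᴴ * (A * R) ^ (l + 2) + Kᴴ * (A * R) ^ l
          = (2 : ℂ) • (Kᴴ * A * K * (Kᴴ * (A * R) ^ (l + 1))) := by
        calc Kᴴ * (A * R) ^ (l + 2) + Kᴴ * (A * R) ^ l
            = (Kᴴ * (A * R) + Kᴴ * (R * A)) * (A * R) ^ (l + 1) := by
              rw [Matrix.add_mul]
              congr 1
              · rw [pow_succ', Matrix.mul_assoc Kᴴ]
              · rw [pow_succ' _ l, Matrix.mul_assoc, ← Matrix.mul_assoc (R * A), hinv,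
                  Matrix.one_mul]
          _ = _ := by rw [hsum, Matrix.smul_mul, Matrix.mul_assoc]
      have hT : Chebyshev.T ℂ ((l + 2 : ℕ) : ℤ)
          = 2 * X * Chebyshev.T ℂ ((l + 1 : ℕ) : ℤ) - Chebyshev.T ℂ (l : ℤ) := by
        have := Chebyshev.T_add_two ℂ (l : ℤ)
        exact_mod_cast this
      rw [hT, map_sub, map_mul, map_mul, aeval_X, ← h0, ← h1, map_ofNat,
        eq_sub_of_add_eq hstep, Matrix.sub_mul]
      rw [Matrix.smul_mul, two_mul (Kᴴ * A * K), two_smul, Matrix.add_mul]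
      simp only [Matrix.mul_assoc]

end Compression

variable {V : Type*} [Fintype V] [DecidableEq V]

theorem zeroReflection_eq (z : V → ℂ) :
    zeroReflection z = (2 : ℂ) • (tensorRight V z * (tensorRight V z)ᴴ) - 1 := by
  ext p q
  rcases p with ⟨a, b⟩
  rcases q with ⟨c, d⟩
  by_cases hac : a = c
  · subst hac
    by_cases hbd : b = d <;>
      simp [zeroReflection, tensorRight, rankOne, Matrix.mul_apply, Matrix.vecMulVec_apply,
        apply_ite, hbd]
  · simp [zeroReflection, tensorRight, Matrix.mul_apply, apply_ite, hac]

theorem shiftOperator_mulVec (G : SimpleGraph V) (w : V × V → ℂ) (a b : V) [Decidable (G.Adj a b)] :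
    (shiftOperator G *ᵥ w) (a, b) = if G.Adj a b then w (b, a) else w (a, b) := by
  classical
  have key (p : V × V) : ((a, b) = if G.Adj p.1 p.2 then p.swap else p) ↔
      p = if G.Adj a b then (b, a) else (a, b) := by
    rcases p with ⟨c, d⟩
    by_cases h : G.Adj a b <;> by_cases h' : G.Adj c d <;>
      simp only [h, h', if_true, if_false, Prod.swap_prod_mk, Prod.mk.injEq]
    · tauto
    · constructor
      · rintro ⟨rfl, rfl⟩; exact absurd h h'
      · rintro ⟨rfl, rfl⟩; exact absurd h.symm h'
    · constructor
      · rintro ⟨rfl, rfl⟩; exact absurd h'.symm h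
      · rintro ⟨rfl, rfl⟩; exact absurd h' h
    · tauto
  have : (shiftOperator G *ᵥ w) (a, b)
      = ∑ p, if p = (if G.Adj a b then (b, a) else (a, b)) then w p else 0 := by
    simp only [shiftOperator, Matrix.mulVec, dotProduct, Matrix.of_apply, ite_mul, one_mul,
      zero_mul]
    refine Finset.sum_congr rfl fun p _ => ?_
    by_cases h : p = if G.Adj a b then (b, a) else (a, b)
    · rw [if_pos h, if_pos]; convert (key p).2 h
    · rw [if_neg h, if_neg]; intro h'; apply h; apply (key p).1; convert h'
  rw [this]
  split_ifs <;> simp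

theorem shiftOperator_mul_self (G : SimpleGraph V) : shiftOperator G * shiftOperator G = 1 := by
  classical
  apply Matrix.mulVec_injective
  funext w
  ext ⟨a, b⟩
  rw [← Matrix.mulVec_mulVec, shiftOperator_mulVec, shiftOperator_mulVec, shiftOperator_mulVec,
    Matrix.one_mulVec]
  by_cases h : G.Adj a b
  · simp [h, h.symm]
  · simp [h]

/-- Compressing the shift, conjugated by the state preparation, to `|0̄⟩` gives the discriminant:
`⟨x, P_x| S |y, P_y⟩ = √(P x y) √(P y x)`. -/
theorem compression_shift_eq_discriminant {G : SimpleGraph V} {P : Matrix V V ℝ} {z : V → ℂ}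
    {U : Matrix (V × V) (V × V) ℂ} (hP : IsMarkovChainOn G P) (hU : IsStatePreparation P z U) :
    (tensorRight V z)ᴴ * (Uᴴ * shiftOperator G * U) * tensorRight V z = discriminant P := by
  classical
  have hcol (x : V) : (U * tensorRight V z) *ᵥ Pi.single x 1
      = tensor (Pi.single x 1) (fun y => ((√(P x y) : ℝ) : ℂ)) := by
    rw [← Matrix.mulVec_mulVec, tensorRight_mulVec, hU.apply]
  have hentry (p : V × V) (x : V) : (U * tensorRight V z) p x
      = if p.1 = x then ((√(P x p.2) : ℝ) : ℂ) else 0 := by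
    have := congrFun (hcol x) p
    rw [Matrix.mulVec_single_one] at this
    simpa [tensor, Pi.single_apply] using this
  have hassoc : (tensorRight V z)ᴴ * (Uᴴ * shiftOperator G * U) * tensorRight V z
      = (U * tensorRight V z)ᴴ * (shiftOperator G * (U * tensorRight V z)) := by
    simp only [Matrix.conjTranspose_mul, Matrix.mul_assoc]
  have hS (x y a b : V) (hxy : a = x) : (shiftOperator G * (U * tensorRight V z)) (a, b) y
      = if b = y then ((√(P y x) : ℝ) : ℂ) else 0 := by
    subst hxy
    have h1 : (shiftOperator G * (U * tensorRight V z)) (a, b) y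
        = (shiftOperator G *ᵥ fun p => (U * tensorRight V z) p y) (a, b) := rfl
    rw [h1, shiftOperator_mulVec]
    simp only [hentry]
    split_ifs with h2 h3 h4 h5 h6
    · rfl
    · rfl
    · subst h4; subst h5; rfl
    · subst h4
      -- a pair that is not an edge carries no amplitude
      have : P a b = 0 := by
        by_contra h0
        exact h2 (hP.edge a b (Ne.symm h5) (lt_of_le_of_ne (hP.nonneg _ _) (Ne.symm h0)))
      simp [this]
    · subst h6
      have : P b a = 0 := by
        by_contra h0
        exact h2 (hP.edge b a (Ne.symm h4)
          (lt_of_le_of_ne (hP.nonneg _ _) (Ne.symm h0))).symm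
      simp [this]
    · rfl
  ext x y
  rw [hassoc, Matrix.mul_apply, Fintype.sum_prod_type]
  rw [Finset.sum_eq_single x, Finset.sum_eq_single y]
  · rw [Matrix.conjTranspose_apply, hentry, hS x y x y rfl]
    simp [discriminant, Real.sqrt_mul (hP.nonneg x y)]
  · intro b _ hb
    rw [hS x y x b rfl, if_neg hb, mul_zero]
  · simp
  · intro a _ ha
    refine Finset.sum_eq_zero fun b _ => ?_
    rw [Matrix.conjTranspose_apply, hentry, if_neg ha, star_zero, zero_mul]
  · simp

/-- `⟨0̄| W^l |0̄⟩ = T_l(D)`. -/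
theorem compression_walk_pow {G : SimpleGraph V} {P : Matrix V V ℝ} {z : V → ℂ}
    {U : Matrix (V × V) (V × V) ℂ} (hP : IsMarkovChainOn G P) (hz : stateNorm z = 1)
    (hU : IsStatePreparation P z U) (l : ℕ) :
    (tensorRight V z)ᴴ * walkOperator G z U ^ l * tensorRight V z
      = aeval (discriminant P) (Chebyshev.T ℂ (l : ℤ)) := by
  have hA : Uᴴ * shiftOperator G * U * (Uᴴ * shiftOperator G * U) = 1 := by
    calc Uᴴ * shiftOperator G * U * (Uᴴ * shiftOperator G * U)
        = Uᴴ * shiftOperator G * (U * Uᴴ) * (shiftOperator G * U) := by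
          simp only [Matrix.mul_assoc]
      _ = Uᴴ * (shiftOperator G * shiftOperator G) * U := by
          rw [self_mul_conjTranspose_of_mem_unitaryGroup hU.unitary]
          simp only [Matrix.mul_assoc, Matrix.one_mul]
      _ = 1 := by
          rw [shiftOperator_mul_self, Matrix.mul_one,
            conjTranspose_mul_self_of_mem_unitaryGroup hU.unitary]
  rw [← compression_shift_eq_discriminant hP hU, walkOperator, zeroReflection_eq,
    compression_pow_eq_aeval_T (tensorRight_isometry hz) hA]

end Walk

/-! ### Operators of circuits -/

section Circuits

section Kronecker

variable {α β γ δ : Type*} [Fintype β] [Fintype δ]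

theorem kronecker_mulVec_apply (A : Matrix α β ℂ) (B : Matrix γ δ ℂ) (φ : β × δ → ℂ) (i : α)
    (j : γ) :
    ((A ⊗ₖ B) *ᵥ φ) (i, j) = (A *ᵥ fun i' => (B *ᵥ fun j' => φ (i', j')) j) i := by
  simp [Matrix.mulVec, dotProduct, Fintype.sum_prod_type, Finset.mul_sum, mul_assoc]

theorem kronecker_mulVec_tensor (A : Matrix α β ℂ) (B : Matrix γ δ ℂ) (u : β → ℂ) (v : δ → ℂ) :
    (A ⊗ₖ B) *ᵥ tensor u v = tensor (A *ᵥ u) (B *ᵥ v) := by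
  ext ⟨i, j⟩
  simp [tensor, Matrix.mulVec, dotProduct, Fintype.sum_prod_type, Finset.sum_mul_sum,
    mul_mul_mul_comm]

theorem tensor_sub_left {α γ : Type*} (u u' : α → ℂ) (v : γ → ℂ) :
    tensor (u - u') v = tensor u v - tensor u' v := by
  ext; simp [tensor, sub_mul]

end Kronecker

section RankOne

theorem rankOne_conjTranspose {α : Type*} (v : α → ℂ) : (rankOne v)ᴴ = rankOne v := by
  ext i j
  simp [rankOne, Matrix.vecMulVec_apply, mul_comm]

variable {α : Type*} [Fintype α]

theorem rankOne_mulVec (v w : α → ℂ) : rankOne v *ᵥ w = (star v ⬝ᵥ w) • v := by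
  ext i
  simp [rankOne, Matrix.mulVec, dotProduct, Matrix.vecMulVec_apply, Finset.mul_sum, mul_comm,
    mul_left_comm]

theorem star_dotProduct_self_of_unit {v : α → ℂ} (hv : stateNorm v = 1) : star v ⬝ᵥ v = 1 := by
  rw [← stateNorm_sq_eq_dotProduct, hv]; simp

theorem rankOne_mulVec_self {v : α → ℂ} (hv : stateNorm v = 1) : rankOne v *ᵥ v = v := by
  rw [rankOne_mulVec, star_dotProduct_self_of_unit hv, one_smul]

theorem rankOne_mul_self {v : α → ℂ} (hv : stateNorm v = 1) :
    rankOne v * rankOne v = rankOne v := by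
  rw [rankOne, Matrix.vecMulVec_mul_vecMulVec, star_dotProduct_self_of_unit hv, one_smul]

end RankOne

theorem stateNorm_zeroKet (τ : ℕ) : stateNorm (zeroKet τ) = 1 := stateNorm_single _

section PauliMatrices

theorem pauliX_conjTranspose : pauliXᴴ = pauliX := by
  ext a b; cases a <;> cases b <;> simp [pauliX]

theorem pauliX_mul_self : pauliX * pauliX = 1 := by
  ext a b; cases a <;> cases b <;> simp [pauliX, Matrix.mul_apply]

theorem pauliX_mulVec_single (b : Bool) :
    pauliX *ᵥ Pi.single b 1 = Pi.single (!b) 1 := by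
  ext a; cases a <;> cases b <;> simp [pauliX]

theorem pauliZ_conjTranspose : pauliZᴴ = pauliZ := by
  ext a b; cases a <;> cases b <;> simp [pauliZ]

theorem pauliZ_mul_self : pauliZ * pauliZ = 1 := by
  ext a b; cases a <;> cases b <;> simp [pauliZ, Matrix.mul_apply]

end PauliMatrices

variable {m τ : ℕ}

/-- The operator on the four registers that applies `f l` to `R₁ R₂` when `R₃` is in the basis
state `l`. -/
def blockControlled (f : Bits τ → Matrix (Bits m × Bits m) (Bits m × Bits m) ℂ) :
    Matrix (Basis m τ) (Basis m τ) ℂ :=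
  Matrix.of fun p q => if p.2.2 = q.2.2 then f q.2.2.1 (p.1, p.2.1) (q.1, q.2.1) else 0

theorem blockControlled_mulVec (f : Bits τ → Matrix (Bits m × Bits m) (Bits m × Bits m) ℂ)
    (φ : Basis m τ → ℂ) (x y : Bits m) (l : Bits τ) (b : Bool) :
    (blockControlled f *ᵥ φ) (x, y, l, b) = (f l *ᵥ fun q => φ (q.1, q.2, l, b)) (x, y) := by
  simp only [blockControlled, Matrix.mulVec, dotProduct, Fintype.sum_prod_type, Matrix.of_apply,
    ite_mul, zero_mul]
  refine Finset.sum_congr rfl fun x' _ => Finset.sum_congr rfl fun y' _ => ?_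
  rw [Finset.sum_eq_single l, Finset.sum_eq_single b]
  · simp
  · intro b' _ hb; simp [Ne.symm hb]
  · simp
  · intro l' _ hl; simp [Ne.symm hl]
  · simp

theorem blockControlled_mul (f g : Bits τ → Matrix (Bits m × Bits m) (Bits m × Bits m) ℂ) :
    blockControlled f * blockControlled g = blockControlled fun l => f l * g l := by
  apply Matrix.mulVec_injective
  funext φ
  ext ⟨x, y, l, b⟩
  rw [← Matrix.mulVec_mulVec, blockControlled_mulVec, blockControlled_mulVec,
    ← Matrix.mulVec_mulVec]
  congr 2
  funext q
  exact blockControlled_mulVec g φ q.1 q.2 l b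

theorem blockControlled_one :
    blockControlled (fun _ : Bits τ => (1 : Matrix (Bits m × Bits m) (Bits m × Bits m) ℂ)) = 1 := by
  apply Matrix.mulVec_injective
  funext φ
  ext ⟨x, y, l, b⟩
  rw [blockControlled_mulVec, Matrix.one_mulVec, Matrix.one_mulVec]

theorem blockControlled_conjTranspose
    (f : Bits τ → Matrix (Bits m × Bits m) (Bits m × Bits m) ℂ) :
    (blockControlled f)ᴴ = blockControlled fun l => (f l)ᴴ := by
  ext p q
  by_cases h : p.2.2 = q.2.2
  · simp [blockControlled, h]
  · simp [blockControlled, h, Ne.symm h]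

section Eval

variable (W : Matrix (Bits m × Bits m) (Bits m × Bits m) ℂ)

theorem Gate.eval_call (k : Fin τ) (inv : Bool) :
    (Gate.call k inv : Gate m τ).eval W
      = blockControlled fun l => if l k then (if inv then Wᴴ else W) else 1 := rfl

theorem Gate.eval_adj (g : Gate m τ) : g.adj.eval W = (g.eval W)ᴴ := by
  cases g with
  | loc U => simp [Gate.adj, Gate.eval, Matrix.conjTranspose_kronecker]
  | call k inv =>
    rw [Gate.adj, Gate.eval_call, Gate.eval_call, blockControlled_conjTranspose]
    congr 1
    funext l
    cases inv <;> cases l k <;> simp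

theorem Gate.IsUnitary.adj {g : Gate m τ} (hg : g.IsUnitary) : g.adj.IsUnitary := by
  cases g with
  | loc U => exact Unitary.star_mem hg
  | call k inv => trivial

theorem Circuit.eval_append (C₁ C₂ : Circuit m τ) :
    Circuit.eval W (C₁ ++ C₂ : Circuit m τ) = Circuit.eval W C₂ * Circuit.eval W C₁ := by
  induction C₁ with
  | nil => simp [Circuit.eval]
  | cons g C ih =>
    rw [List.cons_append, Circuit.eval, ih, Circuit.eval, Matrix.mul_assoc]

theorem Circuit.eval_singleton (g : Gate m τ) : Circuit.eval W ([g] : Circuit m τ) = g.eval W := by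
  simp [Circuit.eval]

theorem Circuit.eval_adj (C : Circuit m τ) :
    Circuit.eval W (Circuit.adj C) = (Circuit.eval W C)ᴴ := by
  induction C with
  | nil => simp [Circuit.adj, Circuit.eval]
  | cons g C ih =>
    rw [Circuit.adj, List.map_cons, List.reverse_cons, Circuit.eval_append, Circuit.eval_singleton,
      Gate.eval_adj, Circuit.eval, Matrix.conjTranspose_mul, ← ih]
    rfl

variable {W}

theorem Gate.eval_mem_unitaryGroup (hW : W ∈ Matrix.unitaryGroup (Bits m × Bits m) ℂ)
    {g : Gate m τ} (hg : g.IsUnitary) : g.eval W ∈ Matrix.unitaryGroup (Basis m τ) ℂ := by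
  cases g with
  | loc U => exact Matrix.kronecker_mem_unitary (one_mem _) hg
  | call k inv =>
    have h1 := conjTranspose_mul_self_of_mem_unitaryGroup hW
    have h2 := self_mul_conjTranspose_of_mem_unitaryGroup hW
    rw [Matrix.mem_unitaryGroup_iff', Matrix.star_eq_conjTranspose, Gate.eval_call,
      blockControlled_conjTranspose, blockControlled_mul, ← blockControlled_one]
    congr 1
    funext l
    cases inv <;> cases l k <;> simp [h1, h2]

theorem Circuit.eval_mem_unitaryGroup (hW : W ∈ Matrix.unitaryGroup (Bits m × Bits m) ℂ)
    {C : Circuit m τ} (hC : ∀ g ∈ C, g.IsUnitary) :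
    Circuit.eval W C ∈ Matrix.unitaryGroup (Basis m τ) ℂ := by
  induction C with
  | nil => exact one_mem _
  | cons g C ih =>
    exact mul_mem (ih fun g hg => hC g (List.mem_cons_of_mem _ hg))
      (Gate.eval_mem_unitaryGroup hW (hC g List.mem_cons_self))

end Eval

/-! ### The controlled powers -/

/-- The integer `l < 2^τ` with the given binary digits, the qubit `k` having the place value
`2^k`. -/
def bitsEquiv (τ : ℕ) : Bits τ ≃ Fin (2 ^ τ) :=
  (Equiv.arrowCongr (Equiv.refl _) finTwoEquiv.symm).trans finFunctionFinEquiv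

theorem bitsEquiv_val (l : Bits τ) :
    (bitsEquiv τ l : ℕ) = ((List.finRange τ).map fun k => if l k then 2 ^ (k : ℕ) else 0).sum := by
  rw [← Fin.sum_univ_def, bitsEquiv, Equiv.trans_apply, finFunctionFinEquiv_apply]
  refine Finset.sum_congr rfl fun k _ => ?_
  simp only [Equiv.arrowCongr_apply, Equiv.refl_symm, Equiv.coe_refl, Function.comp_apply, id_eq]
  cases l k <;> simp [finTwoEquiv]

theorem eval_replicate_call (W : Matrix (Bits m × Bits m) (Bits m × Bits m) ℂ) (k : Fin τ)
    (n : ℕ) :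
    Circuit.eval W (List.replicate n (Gate.call k false) : Circuit m τ)
      = blockControlled fun l => W ^ (if l k then n else 0) := by
  induction n with
  | zero => simp [Circuit.eval, blockControlled_one]
  | succ n ih =>
    rw [List.replicate_succ, Circuit.eval, ih, Gate.eval_call, blockControlled_mul]
    congr 1
    funext l
    cases l k <;> simp [pow_succ]

/-- The circuit of the controlled powers applies `W ^ l` when `R₃` is in the basis state `l`. -/
theorem eval_ctrlPowers (W : Matrix (Bits m × Bits m) (Bits m × Bits m) ℂ) :
    Circuit.eval W (ctrlPowers m τ) = blockControlled fun l => W ^ (bitsEquiv τ l : ℕ) := by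
  simp only [bitsEquiv_val]
  rw [ctrlPowers]
  induction List.finRange τ with
  | nil => simp [Circuit.eval, blockControlled_one]
  | cons k L ih =>
    rw [List.flatMap_cons, Circuit.eval_append, ih, eval_replicate_call, blockControlled_mul]
    congr 1
    funext l
    rw [← pow_add, List.map_cons, List.sum_cons, add_comm]

theorem calls_ctrlPowers : Circuit.calls (ctrlPowers m τ) = 2 ^ τ - 1 := by
  have h : Circuit.calls (ctrlPowers m τ) = ∑ k : Fin τ, 2 ^ (k : ℕ) := by
    rw [Fin.sum_univ_def, ctrlPowers]
    induction List.finRange τ with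
    | nil => rfl
    | cons k L ih =>
      rw [List.flatMap_cons, Circuit.calls, List.map_append, List.sum_append, List.map_cons,
        List.sum_cons, ← ih]
      simp [Gate.calls, Circuit.calls]
  rw [h, Fin.sum_univ_eq_sum_range (fun k => 2 ^ k), Nat.geomSum_eq le_rfl]
  simp

theorem calls_adj (C : Circuit m τ) : Circuit.calls (Circuit.adj C) = Circuit.calls C := by
  have h : (Gate.calls ∘ Gate.adj : Gate m τ → ℕ) = Gate.calls := by
    funext g; cases g <;> rfl
  rw [Circuit.calls, Circuit.adj, List.map_reverse, List.sum_reverse, List.map_map, h,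
    Circuit.calls]

theorem calls_fastForward (Vq : Matrix (Bits τ) (Bits τ) ℂ) :
    Circuit.calls (fastForward m Vq) = 2 ^ τ - 1 := by
  have h := calls_ctrlPowers (m := m) (τ := τ)
  simp only [Circuit.calls] at h
  simp [Circuit.calls, fastForward, gateOnThree, Gate.calls, h]

theorem calls_reflectionCircuit (z : Bits m → ℂ) (Vq : Matrix (Bits τ) (Bits τ) ℂ) :
    Circuit.calls (reflectionCircuit z Vq) = 2 * (2 ^ τ - 1) := by
  have h1 := calls_fastForward (m := m) Vq
  have h2 := calls_adj (fastForward m Vq)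
  simp only [Circuit.calls] at h1 h2
  simp only [Circuit.calls, reflectionCircuit, List.map_append, List.sum_append, h2, h1, ccX, ccZ,
    List.map_cons, List.map_nil, Gate.calls]
  simp
  ring

/-! ### Unitarity of the gates -/

/-- Replacing the identity by `Y` on the range of the projection `Q` gives a unitary if `Y` is
Hermitian with square `Q`. -/
theorem add_one_sub_mem_unitaryGroup {ι : Type*} [Fintype ι] [DecidableEq ι] {Q Y : Matrix ι ι ℂ}
    (hQ : Qᴴ = Q) (hY : Yᴴ = Y) (hQQ : Q * Q = Q) (hYY : Y * Y = Q) (hQY : Q * Y = Y)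
    (hYQ : Y * Q = Y) : Y + (1 - Q) ∈ Matrix.unitaryGroup ι ℂ := by
  rw [Matrix.mem_unitaryGroup_iff', Matrix.star_eq_conjTranspose, Matrix.conjTranspose_add,
    Matrix.conjTranspose_sub, Matrix.conjTranspose_one, hQ, hY]
  simp only [add_mul, mul_add, sub_mul, mul_sub, hQQ, hYY, hQY, hYQ, one_mul, mul_one]
  abel

theorem ccX_isUnitary {z : Bits m → ℂ} (hz : stateNorm z = 1) : (ccX τ z).IsUnitary := by
  have h : (1 - rankOne z) ⊗ₖ (1 : Matrix (Bits τ × Bool) (Bits τ × Bool) ℂ)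
      = 1 - rankOne z ⊗ₖ (1 : Matrix (Bits τ × Bool) (Bits τ × Bool) ℂ) := by
    rw [eq_sub_iff_add_eq, ← Matrix.add_kronecker, sub_add_cancel, Matrix.one_kronecker_one]
  rw [ccX, Gate.IsUnitary, h]
  apply add_one_sub_mem_unitaryGroup <;>
    simp only [Matrix.conjTranspose_kronecker, rankOne_conjTranspose, pauliX_conjTranspose,
      Matrix.conjTranspose_one, ← Matrix.mul_kronecker_mul, rankOne_mul_self hz, pauliX_mul_self,
      one_mul, mul_one, Matrix.one_kronecker_one]

theorem ccZ_isUnitary {z : Bits m → ℂ} (hz : stateNorm z = 1) : (ccZ τ z).IsUnitary := by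
  rw [ccZ, Gate.IsUnitary]
  apply add_one_sub_mem_unitaryGroup <;>
    simp only [Matrix.conjTranspose_kronecker, rankOne_conjTranspose, pauliZ_conjTranspose,
      Matrix.conjTranspose_one, ← Matrix.mul_kronecker_mul, rankOne_mul_self hz,
      rankOne_mul_self (stateNorm_zeroKet τ), pauliZ_mul_self, one_mul, mul_one]

theorem gateOnThree_isUnitary {Vq : Matrix (Bits τ) (Bits τ) ℂ}
    (hV : Vq ∈ Matrix.unitaryGroup (Bits τ) ℂ) : (gateOnThree Vq : Gate m τ).IsUnitary :=
  Matrix.kronecker_mem_unitary (one_mem _) (Matrix.kronecker_mem_unitary hV (one_mem _))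

theorem fastForward_isUnitary {Vq : Matrix (Bits τ) (Bits τ) ℂ}
    (hV : Vq ∈ Matrix.unitaryGroup (Bits τ) ℂ) : ∀ g ∈ fastForward m Vq, g.IsUnitary := by
  intro g hg
  simp only [fastForward, ctrlPowers, List.mem_append, List.mem_singleton, List.mem_flatMap,
    List.mem_replicate] at hg
  rcases hg with (rfl | ⟨k, _, _, rfl⟩) | rfl
  · exact gateOnThree_isUnitary hV
  · trivial
  · exact gateOnThree_isUnitary (Unitary.star_mem hV)

theorem reflectionCircuit_isUnitary {z : Bits m → ℂ} (hz : stateNorm z = 1)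
    {Vq : Matrix (Bits τ) (Bits τ) ℂ} (hV : Vq ∈ Matrix.unitaryGroup (Bits τ) ℂ) :
    ∀ g ∈ reflectionCircuit z Vq, g.IsUnitary := by
  intro g hg
  simp only [reflectionCircuit, Circuit.adj, List.mem_append, List.mem_singleton,
    List.mem_reverse, List.mem_map] at hg
  rcases hg with (((rfl | hg) | rfl) | ⟨g', hg', rfl⟩) | rfl
  · exact ccX_isUnitary hz
  · exact fastForward_isUnitary hV g hg
  · exact ccZ_isUnitary hz
  · exact (fastForward_isUnitary hV g' hg').adj
  · exact ccX_isUnitary hz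

/-! ### Action of the fast-forwarding circuit -/

/-- The state `u ⊗ z ⊗ |0^τ⟩ ⊗ |b⟩` of the four registers. -/
def registerState (τ : ℕ) (z u : Bits m → ℂ) (b : Bool) : Basis m τ → ℂ :=
  tensor u (tensor z (tensor (zeroKet τ) (Pi.single b 1)))

theorem stateNorm_registerState {z : Bits m → ℂ} (hz : stateNorm z = 1) (u : Bits m → ℂ)
    (b : Bool) : stateNorm (registerState τ z u b) = stateNorm u := by
  simp [registerState, stateNorm_tensor, hz, stateNorm_zeroKet, stateNorm_single]

theorem zeroProjection_conjTranspose (z : Bits m → ℂ) :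
    (zeroProjection τ z)ᴴ = zeroProjection τ z := by
  simp [zeroProjection, Matrix.conjTranspose_kronecker, rankOne_conjTranspose]

theorem zeroProjection_mulVec_registerState {z : Bits m → ℂ} (hz : stateNorm z = 1)
    (u : Bits m → ℂ) (b : Bool) :
    zeroProjection τ z *ᵥ registerState τ z u b = registerState τ z u b := by
  simp only [zeroProjection, registerState, kronecker_mulVec_tensor, Matrix.one_mulVec,
    rankOne_mulVec_self hz, rankOne_mulVec_self (stateNorm_zeroKet τ)]

theorem eval_gateOnThree_mulVec (W : Matrix (Bits m × Bits m) (Bits m × Bits m) ℂ)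
    (Vq : Matrix (Bits τ) (Bits τ) ℂ) (φ : Basis m τ → ℂ) (x y : Bits m) (l : Bits τ) (b : Bool) :
    ((gateOnThree Vq).eval W *ᵥ φ) (x, y, l, b) = (Vq *ᵥ fun l' => φ (x, y, l', b)) l := by
  simp only [gateOnThree, Gate.eval, kronecker_mulVec_apply, Matrix.one_mulVec]

theorem eval_fastForward (W : Matrix (Bits m × Bits m) (Bits m × Bits m) ℂ)
    (Vq : Matrix (Bits τ) (Bits τ) ℂ) :
    Circuit.eval W (fastForward m Vq) = (gateOnThree Vqᴴ).eval W *
      (blockControlled (fun l => W ^ (bitsEquiv τ l : ℕ)) * (gateOnThree Vq).eval W) := by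
  rw [fastForward, Circuit.eval_append, Circuit.eval_append, Circuit.eval_singleton,
    Circuit.eval_singleton, eval_ctrlPowers]

/-- Linear combination of unitaries: if `V_q |0^τ⟩ = s`, then in the block selected by `|0̄⟩|0^τ⟩`
the fast-forwarding circuit is `∑_l |s_l|² ⟨0̄| W^l |0̄⟩`. -/
theorem zeroProjection_fastForward_mulVec (W : Matrix (Bits m × Bits m) (Bits m × Bits m) ℂ)
    {Vq : Matrix (Bits τ) (Bits τ) ℂ} {s : Bits τ → ℂ} (hs : Vq *ᵥ zeroKet τ = s)
    (z u : Bits m → ℂ) (b : Bool) :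
    zeroProjection τ z *ᵥ (Circuit.eval W (fastForward m Vq) *ᵥ registerState τ z u b)
      = registerState τ z ((∑ l, (star (s l) * s l) • ((tensorRight (Bits m) z)ᴴ *
          W ^ (bitsEquiv τ l : ℕ) * tensorRight (Bits m) z)) *ᵥ u) b := by
  have hV (l : Bits τ) : Vq l (fun _ => false) = s l := by
    rw [← hs, zeroKet, Matrix.mulVec_single_one]; rfl
  have hin : (gateOnThree Vq).eval W *ᵥ registerState τ z u b
      = tensor u (tensor z (tensor s (Pi.single b 1))) := by
    rw [← hs]
    simp only [gateOnThree, Gate.eval, registerState, kronecker_mulVec_tensor, Matrix.one_mulVec]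
  have hctrl (x y : Bits m) (l : Bits τ) (b' : Bool) :
      (blockControlled (fun l => W ^ (bitsEquiv τ l : ℕ)) *ᵥ
        tensor u (tensor z (tensor s (Pi.single b 1)))) (x, y, l, b')
        = s l * (Pi.single b 1 : Bool → ℂ) b' *
          (W ^ (bitsEquiv τ l : ℕ) *ᵥ tensor u z) (x, y) := by
    rw [blockControlled_mulVec, ← smul_eq_mul (_ * _), ← Pi.smul_apply, ← Matrix.mulVec_smul]
    congr 2
    funext q
    simp [tensor]
    ring
  rw [eval_fastForward, ← Matrix.mulVec_mulVec, ← Matrix.mulVec_mulVec, hin]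
  ext ⟨x, y, l, b'⟩
  simp only [zeroProjection, kronecker_mulVec_apply, Matrix.one_mulVec, eval_gateOnThree_mulVec,
    hctrl]
  simp only [rankOne_mulVec, Matrix.sum_mulVec, Matrix.smul_mulVec, registerState, tensor,
    ← Matrix.mulVec_mulVec, tensorRight_mulVec, Finset.sum_apply, Pi.smul_apply, smul_eq_mul,
    tensorRight_conjTranspose_mulVec]
  simp only [zeroKet, dotProduct, Pi.star_apply, Matrix.mulVec, Matrix.conjTranspose_apply]
  simp only [Pi.single_apply, apply_ite star, star_one, star_zero, ite_mul, one_mul, zero_mul,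
    Finset.sum_ite_eq', Finset.mem_univ, if_true, hV]
  simp only [Finset.sum_mul, Finset.mul_sum]
  rw [Finset.sum_comm]
  refine Finset.sum_congr rfl fun l' _ => Finset.sum_congr rfl fun y' _ => ?_
  split_ifs <;> simp
  exact Finset.sum_congr rfl fun _ _ => by ring

/-! ### Action of the approximate reflection -/

theorem eval_ccX_mulVec_registerState (W : Matrix (Bits m × Bits m) (Bits m × Bits m) ℂ)
    {z : Bits m → ℂ} (hz : stateNorm z = 1) (u : Bits m → ℂ) (b : Bool) :
    (ccX τ z).eval W *ᵥ registerState τ z u b = registerState τ z u (!b) := by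
  simp only [ccX, Gate.eval, registerState, kronecker_mulVec_tensor, Matrix.one_mulVec,
    Matrix.add_mulVec, Matrix.sub_mulVec, rankOne_mulVec_self hz, pauliX_mulVec_single, sub_self]
  congr 1
  ext
  simp [tensor]

/-- Pauli `Z` on the last register. -/
def lastPauliZ (m τ : ℕ) : Matrix (Basis m τ) (Basis m τ) ℂ :=
  (1 : Matrix (Bits m) (Bits m) ℂ) ⊗ₖ ((1 : Matrix (Bits m) (Bits m) ℂ) ⊗ₖ
    ((1 : Matrix (Bits τ) (Bits τ) ℂ) ⊗ₖ pauliZ))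

theorem lastPauliZ_mulVec (φ : Basis m τ → ℂ) (x y : Bits m) (l : Bits τ) (b : Bool) :
    (lastPauliZ m τ *ᵥ φ) (x, y, l, b) = (if b then -1 else 1) * φ (x, y, l, b) := by
  simp only [lastPauliZ, kronecker_mulVec_apply, Matrix.one_mulVec, pauliZ,
    Matrix.mulVec_diagonal]

theorem eval_ccZ (W : Matrix (Bits m × Bits m) (Bits m × Bits m) ℂ) (z : Bits m → ℂ) :
    (ccZ τ z).eval W = zeroProjection τ z * lastPauliZ m τ + (1 - zeroProjection τ z) := by
  have h (Q : Matrix (Bits m × Bits τ × Bool) (Bits m × Bits τ × Bool) ℂ) :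
      (1 : Matrix (Bits m) (Bits m) ℂ) ⊗ₖ (1 - Q) = 1 - (1 : Matrix (Bits m) (Bits m) ℂ) ⊗ₖ Q := by
    rw [eq_sub_iff_add_eq, ← Matrix.kronecker_add, sub_add_cancel, Matrix.one_kronecker_one]
  simp only [ccZ, Gate.eval, zeroProjection, lastPauliZ, ← Matrix.mul_kronecker_mul, one_mul,
    mul_one, Matrix.kronecker_add, h]

theorem lastPauliZ_commute_fastForward (W : Matrix (Bits m × Bits m) (Bits m × Bits m) ℂ)
    (Vq : Matrix (Bits τ) (Bits τ) ℂ) :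
    Commute (lastPauliZ m τ) (Circuit.eval W (fastForward m Vq)) := by
  have hthree (A : Matrix (Bits τ) (Bits τ) ℂ) :
      Commute (lastPauliZ m τ) ((gateOnThree A).eval W) := by
    simp only [Commute, SemiconjBy, lastPauliZ, gateOnThree, Gate.eval,
      ← Matrix.mul_kronecker_mul, one_mul, mul_one]
  have hblock (f : Bits τ → Matrix (Bits m × Bits m) (Bits m × Bits m) ℂ) :
      Commute (lastPauliZ m τ) (blockControlled f) := by
    apply Matrix.mulVec_injective
    funext φ
    ext ⟨x, y, l, b⟩
    rw [← Matrix.mulVec_mulVec, ← Matrix.mulVec_mulVec, lastPauliZ_mulVec, blockControlled_mulVec,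
      blockControlled_mulVec, ← smul_eq_mul, ← Pi.smul_apply, ← Matrix.mulVec_smul]
    congr 2
    funext q
    rw [lastPauliZ_mulVec]
    rfl
  rw [eval_fastForward]
  exact (hthree _).mul_right ((hblock _).mul_right (hthree _))

theorem lastPauliZ_mulVec_registerState_true (z u : Bits m → ℂ) :
    lastPauliZ m τ *ᵥ registerState τ z u true = -registerState τ z u true := by
  ext ⟨x, y, l, b⟩
  rw [lastPauliZ_mulVec]
  cases b <;> simp [registerState, tensor]

/-- On inputs `u ⊗ |0̄⟩ ⊗ |0^τ⟩ ⊗ |0⟩` the circuit is `1 - 2 X W_τ† Π W_τ X`, because there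
the controlled `Z` is the reflection `1 - 2 Π`. -/
theorem eval_reflectionCircuit_mulVec (W : Matrix (Bits m × Bits m) (Bits m × Bits m) ℂ)
    (hW : W ∈ Matrix.unitaryGroup (Bits m × Bits m) ℂ)
    {Vq : Matrix (Bits τ) (Bits τ) ℂ} (hV : Vq ∈ Matrix.unitaryGroup (Bits τ) ℂ)
    {z : Bits m → ℂ} (hz : stateNorm z = 1) (u : Bits m → ℂ) :
    Circuit.eval W (reflectionCircuit z Vq) *ᵥ registerState τ z u false
      = registerState τ z u false - (2 : ℂ) • ((ccX τ z).eval W *ᵥ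
          ((Circuit.eval W (fastForward m Vq))ᴴ *ᵥ (zeroProjection τ z *ᵥ
            (Circuit.eval W (fastForward m Vq) *ᵥ registerState τ z u true)))) := by
  set A := Circuit.eval W (fastForward m Vq) with hA
  have hAu : Aᴴ * A = 1 := conjTranspose_mul_self_of_mem_unitaryGroup
    (Circuit.eval_mem_unitaryGroup hW (fastForward_isUnitary hV))
  have hZ : (ccZ τ z).eval W *ᵥ (A *ᵥ registerState τ z u true)
      = A *ᵥ registerState τ z u true
        - (2 : ℂ) • (zeroProjection τ z *ᵥ (A *ᵥ registerState τ z u true)) := by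
    have h : lastPauliZ m τ *ᵥ (A *ᵥ registerState τ z u true)
        = -(A *ᵥ registerState τ z u true) := by
      rw [Matrix.mulVec_mulVec, (lastPauliZ_commute_fastForward W Vq).eq, ← Matrix.mulVec_mulVec,
        lastPauliZ_mulVec_registerState_true, Matrix.mulVec_neg]
    rw [eval_ccZ, Matrix.add_mulVec, ← Matrix.mulVec_mulVec, h, Matrix.sub_mulVec,
      Matrix.one_mulVec, Matrix.mulVec_neg, two_smul]
    abel
  rw [reflectionCircuit]
  simp only [Circuit.eval_append, Circuit.eval_singleton, Circuit.eval_adj, ← hA,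
    ← Matrix.mulVec_mulVec]
  rw [eval_ccX_mulVec_registerState W hz, Bool.not_false, hZ, Matrix.mulVec_sub,
    Matrix.mulVec_mulVec _ Aᴴ A, hAu, Matrix.one_mulVec, Matrix.mulVec_sub,
    eval_ccX_mulVec_registerState W hz, Bool.not_true, Matrix.mulVec_smul, Matrix.mulVec_smul]

end Circuits

/-! ### Spectral theory of reversible Markov chains -/

section Markov

variable {V : Type*} [Fintype V] {G : SimpleGraph V} {P : Matrix V V ℝ}

theorem sqrt_mul_swap_eq (hP : IsMarkovChainOn G P) {r : V → ℝ} (hr : ∀ x, 0 < r x)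
    (hdb : ∀ x y, r x ^ 2 * P x y = r y ^ 2 * P y x) (x y : V) :
    √(P x y * P y x) = r x * P x y * (r y)⁻¹ := by
  have hx := hr x
  have hy := hr y
  have h0 : 0 ≤ r x * P x y * (r y)⁻¹ := by
    have := hP.nonneg x y
    positivity
  rw [Real.sqrt_eq_iff_mul_self_eq (mul_nonneg (hP.nonneg _ _) (hP.nonneg _ _)) h0]
  have h := hdb x y
  field_simp
  linear_combination -(P x y) * h

theorem discriminant_isHermitian {V : Type*} (P : Matrix V V ℝ) : (discriminant P).IsHermitian := by
  ext x y
  simp [discriminant, mul_comm]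
/-- The eigenvalue `1` of the discriminant is attained at the square root of the reversing
measure. -/
theorem discriminant_mulVec_sqrt (hP : IsMarkovChainOn G P) {r : V → ℝ} (hr : ∀ x, 0 < r x)
    (hdb : ∀ x y, r x ^ 2 * P x y = r y ^ 2 * P y x) :
    discriminant P *ᵥ (fun x => (r x : ℂ)) = fun x => (r x : ℂ) := by
  ext x
  simp only [Matrix.mulVec, dotProduct, discriminant, Matrix.of_apply]
  rw [← Complex.ofReal_inj.2 (mul_one (r x)), ← hP.row_sum x, Finset.mul_sum]
  push_cast
  refine Finset.sum_congr rfl fun y _ => ?_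
  rw [sqrt_mul_swap_eq hP hr hdb]
  have := (hr y).ne'
  norm_cast
  field_simp

theorem IsEigenbasis.abs_le_one
    {ψ : OrthonormalBasis (Fin (Fintype.card V)) ℂ (EuclideanSpace ℂ V)}
    {lam : Fin (Fintype.card V) → ℝ} (h : IsEigenbasis P ψ lam)
    (hD : ∀ v : V → ℂ, stateNorm (discriminant P *ᵥ v) ≤ stateNorm v)
    (j : Fin (Fintype.card V)) : |lam j| ≤ 1 := by
  have := hD (ψ j).ofLp
  rwa [h.eigen, stateNorm_smul, stateNorm_orthonormalBasis, mul_one, Complex.norm_real,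
    Real.norm_eq_abs] at this

variable [DecidableEq V]

theorem IsMarkovChainOn.pow_nonneg (hP : IsMarkovChainOn G P) (k : ℕ) (x y : V) :
    0 ≤ (P ^ k) x y := by
  induction k generalizing x y with
  | zero =>
    rw [pow_zero, Matrix.one_apply]
    split_ifs <;> norm_num
  | succ k ih =>
    rw [pow_succ, Matrix.mul_apply]
    exact Finset.sum_nonneg fun z _ => mul_nonneg (ih x z) (hP.nonneg z y)

/-- A function that is constant along the transitions of an irreducible chain is constant. -/
theorem IsErgodic.eq_of_forall_transition {α : Type*} (hP : IsMarkovChainOn G P)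
    (hE : IsErgodic P) {f : V → α} (hf : ∀ x y, 0 < P x y → f x = f y) (x y : V) : f x = f y := by
  have key (k : ℕ) : ∀ y, 0 < (P ^ k) x y → f x = f y := by
    induction k with
    | zero =>
      intro y h
      by_contra hne
      have hxy : x ≠ y := fun h' => hne (congrArg f h')
      rw [pow_zero, Matrix.one_apply_ne hxy] at h
      exact lt_irrefl _ h
    | succ k ih =>
      intro y h
      rw [pow_succ, Matrix.mul_apply] at h
      obtain ⟨w, -, hw⟩ := Finset.exists_lt_of_sum_lt (s := Finset.univ) (f := fun _ : V => (0 : ℝ))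
        (by simpa using h)
      have h1 : 0 < (P ^ k) x w :=
        lt_of_le_of_ne (hP.pow_nonneg k x w) fun h0 => by rw [← h0, zero_mul] at hw; simp at hw
      have h2 : 0 < P w y :=
        lt_of_le_of_ne (hP.nonneg w y) fun h0 => by rw [← h0, mul_zero] at hw; simp at hw
      rw [ih w h1, hf w y h2]
  obtain ⟨k, hk⟩ := hE.irreducible x y
  exact key k y hk

/-- A reversing measure of an irreducible chain is everywhere positive. The function `r` below is
its square root, which is the eigenvector of the discriminant with eigenvalue `1`. -/
theorem exists_sqrt_reversing_measure (hP : IsMarkovChainOn G P) (hE : IsErgodic P)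
    (hR : IsReversible P) :
    ∃ r : V → ℝ, (∀ x, 0 < r x) ∧ ∀ x y, r x ^ 2 * P x y = r y ^ 2 * P y x := by
  obtain ⟨p, hp0, hp1, hstat, hdb⟩ := hR
  have hpow (k : ℕ) : p ᵥ* P ^ k = p := by
    induction k with
    | zero => simp
    | succ k ih => rw [pow_succ, ← Matrix.vecMul_vecMul, ih, hstat]
  have hpos (y : V) : 0 < p y := by
    obtain ⟨x, -, hx⟩ := Finset.exists_lt_of_sum_lt (s := Finset.univ) (f := fun _ : V => (0 : ℝ))
      (g := p) (by simp [hp1])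
    obtain ⟨k, hk⟩ := hE.irreducible x y
    rw [← congrFun (hpow k) y]
    exact lt_of_lt_of_le (mul_pos hx hk) (Finset.single_le_sum
      (f := fun x => p x * (P ^ k) x y)
      (fun w _ => mul_nonneg (hp0 w) (hP.pow_nonneg k w y)) (Finset.mem_univ x))
  refine ⟨fun x => √(p x), fun x => Real.sqrt_pos.2 (hpos x), fun x y => ?_⟩
  rw [Real.sq_sqrt (hp0 x), Real.sq_sqrt (hp0 y), hdb]

/-- The discriminant is similar to `P`. -/
theorem discriminant_eq_map (hP : IsMarkovChainOn G P) {r : V → ℝ} (hr : ∀ x, 0 < r x)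
    (hdb : ∀ x y, r x ^ 2 * P x y = r y ^ 2 * P y x) :
    discriminant P
      = (Matrix.diagonal r * P * Matrix.diagonal fun x => (r x)⁻¹).map Complex.ofRealHom := by
  ext x y
  rw [Matrix.map_apply, Matrix.mul_diagonal, Matrix.diagonal_mul, discriminant, Matrix.of_apply,
    sqrt_mul_swap_eq hP hr hdb]
  rfl

theorem charpoly_discriminant (hP : IsMarkovChainOn G P) (hE : IsErgodic P) (hR : IsReversible P) :
    (discriminant P).charpoly = P.charpoly.map Complex.ofRealHom := by
  obtain ⟨r, hr, hdb⟩ := exists_sqrt_reversing_measure hP hE hR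
  have h : (Matrix.diagonal fun x => (r x)⁻¹) * Matrix.diagonal r = 1 := by
    rw [Matrix.diagonal_mul_diagonal, ← Matrix.diagonal_one]
    congr 1
    funext x
    exact inv_mul_cancel₀ (hr x).ne'
  rw [discriminant_eq_map hP hr hdb, Matrix.charpoly_map, Matrix.charpoly_mul_comm,
    ← Matrix.mul_assoc, h, Matrix.one_mul]

/-- The eigenvalue `1` of the discriminant is simple: if `r h` is a fixed vector, then `h` is
harmonic for `P`, so its Dirichlet form `∑ r_x² P_xy |h_x - h_y|²` vanishes. -/
theorem exists_eq_smul_sqrt_of_discriminant_mulVec_eq (hP : IsMarkovChainOn G P) (hE : IsErgodic P)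
    [Nonempty V] {r : V → ℝ} (hr : ∀ x, 0 < r x)
    (hdb : ∀ x y, r x ^ 2 * P x y = r y ^ 2 * P y x) {v : V → ℂ} (hv : discriminant P *ᵥ v = v) :
    ∃ c : ℂ, v = c • fun x => (r x : ℂ) := by
  set h : V → ℂ := fun x => v x / r x with hh
  have hrc (x : V) : (r x : ℂ) ≠ 0 := Complex.ofReal_ne_zero.2 (hr x).ne'
  have hharm (x : V) : ∑ y, (P x y : ℂ) * h y = h x := by
    have := congrFun hv x
    simp only [Matrix.mulVec, dotProduct, discriminant, Matrix.of_apply] at this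
    rw [hh]
    simp only
    rw [eq_div_iff (hrc x), ← this, Finset.sum_mul]
    refine Finset.sum_congr rfl fun y _ => ?_
    rw [sqrt_mul_swap_eq hP hr hdb]
    push_cast
    have := hrc y
    field_simp
  have hexp (x y : V) : ‖h x - h y‖ ^ 2
      = ‖h x‖ ^ 2 + ‖h y‖ ^ 2 - 2 * (star (h x) * h y).re := by
    rw [← Complex.normSq_eq_norm_sq, ← Complex.normSq_eq_norm_sq, ← Complex.normSq_eq_norm_sq]
    simp [Complex.normSq_apply]
    ring
  have h1 : ∑ x, ∑ y, r x ^ 2 * P x y * ‖h x‖ ^ 2 = ∑ x, r x ^ 2 * ‖h x‖ ^ 2 := by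
    refine Finset.sum_congr rfl fun x _ => ?_
    rw [← Finset.sum_mul, ← Finset.mul_sum, hP.row_sum, mul_one]
  have h2 : ∑ x, ∑ y, r x ^ 2 * P x y * ‖h y‖ ^ 2 = ∑ x, r x ^ 2 * ‖h x‖ ^ 2 := by
    rw [Finset.sum_comm, ← h1]
    exact Finset.sum_congr rfl fun y _ => Finset.sum_congr rfl fun x _ => by rw [hdb x y]
  have h3 : ∑ x, ∑ y, r x ^ 2 * P x y * (2 * (star (h x) * h y).re)
      = 2 * ∑ x, r x ^ 2 * ‖h x‖ ^ 2 := by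
    rw [Finset.mul_sum]
    refine Finset.sum_congr rfl fun x _ => ?_
    have : ∑ y, P x y * (star (h x) * h y).re = ‖h x‖ ^ 2 := by
      have e : ((‖h x‖ ^ 2 : ℝ) : ℂ) = ∑ y, (P x y : ℂ) * (star (h x) * h y) := by
        simp only [mul_left_comm _ (star (h x))]
        rw [← Finset.mul_sum, hharm x]
        push_cast
        exact (Complex.conj_mul' _).symm
      have e' := congrArg Complex.re e
      rw [Complex.ofReal_re, Complex.re_sum] at e'
      rw [e']
      exact Finset.sum_congr rfl fun y _ => (Complex.re_ofReal_mul _ _).symm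
    rw [← this, Finset.mul_sum, Finset.mul_sum]
    exact Finset.sum_congr rfl fun y _ => by ring
  have hzero : ∑ x, ∑ y, r x ^ 2 * P x y * ‖h x - h y‖ ^ 2 = 0 := by
    simp only [hexp, mul_sub, mul_add, Finset.sum_sub_distrib, Finset.sum_add_distrib]
    rw [h1, h2, h3]
    ring
  have hterm (x y : V) : 0 ≤ r x ^ 2 * P x y * ‖h x - h y‖ ^ 2 := by
    have := hP.nonneg x y
    positivity
  have hconst := hE.eq_of_forall_transition hP (f := h) fun x y hxy => by
    have hx := (Finset.sum_eq_zero_iff_of_nonneg fun x _ =>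
      Finset.sum_nonneg fun y _ => hterm x y).1 hzero x (Finset.mem_univ x)
    have hy := (Finset.sum_eq_zero_iff_of_nonneg fun y _ => hterm x y).1 hx y (Finset.mem_univ y)
    have hne : r x ^ 2 * P x y ≠ 0 := (mul_pos (pow_pos (hr x) 2) hxy).ne'
    have := (mul_eq_zero.1 hy).resolve_left hne
    exact sub_eq_zero.1 (norm_eq_zero.1 (pow_eq_zero_iff two_ne_zero |>.1 this))
  obtain ⟨x₀⟩ := ‹Nonempty V›
  refine ⟨h x₀, funext fun x => ?_⟩
  rw [Pi.smul_apply, smul_eq_mul, hconst x₀ x, hh]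
  exact (div_mul_cancel₀ _ (hrc x)).symm

/-! ### Eigenbases of the discriminant -/

theorem exists_isEigenbasis (P : Matrix V V ℝ) :
    ∃ (ψ : OrthonormalBasis (Fin (Fintype.card V)) ℂ (EuclideanSpace ℂ V))
      (lam : Fin (Fintype.card V) → ℝ), IsEigenbasis P ψ lam := by
  have hD := discriminant_isHermitian P
  refine ⟨hD.eigenvectorBasis.reindex
    (Fintype.equivOfCardEq (Fintype.card_fin _) : Fin (Fintype.card V) ≃ V).symm, hD.eigenvalues₀,
    hD.eigenvalues₀_antitone, fun j => ?_⟩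
  rw [OrthonormalBasis.reindex_apply, Equiv.symm_symm, hD.mulVec_eigenvectorBasis,
    Matrix.IsHermitian.eigenvalues, Equiv.symm_apply_apply]
  rfl

section Eigenbasis

variable {ψ : OrthonormalBasis (Fin (Fintype.card V)) ℂ (EuclideanSpace ℂ V)}
  {lam : Fin (Fintype.card V) → ℝ}

open Polynomial

theorem IsEigenbasis.charpoly_eq (hP : IsMarkovChainOn G P) (hE : IsErgodic P)
    (hR : IsReversible P) (h : IsEigenbasis P ψ lam) :
    P.charpoly = ∏ j, (X - C (lam j)) := by
  set M : Matrix V (Fin (Fintype.card V)) ℂ := Matrix.of fun x j => ψ j x with hM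
  have hMM : Mᴴ * M = 1 := by
    ext i j
    have := orthonormal_iff_ite.1 ψ.orthonormal i j
    rw [Matrix.one_apply, ← this, Matrix.mul_apply, EuclideanSpace.inner_eq_star_dotProduct,
      dotProduct]
    exact Finset.sum_congr rfl fun x _ => by simp [hM, mul_comm]
  have hMM' : M * Mᴴ = 1 := (Matrix.mul_eq_one_comm_of_card_eq _ _ _ (Fintype.card_fin _).symm).2 hMM
  have hDM : discriminant P * M = M * Matrix.diagonal fun j => (lam j : ℂ) := by
    ext x j
    have := congrFun (h.eigen j) x
    rw [Matrix.mul_diagonal, mul_comm]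
    exact this
  have hD : discriminant P = M * (Matrix.diagonal (fun j => (lam j : ℂ)) * Mᴴ) := by
    rw [← Matrix.mul_assoc, ← hDM, Matrix.mul_assoc, hMM', Matrix.mul_one]
  have hchar : (discriminant P).charpoly = ∏ j, (X - C (lam j : ℂ)) := by
    rw [hD, Matrix.charpoly_mul_comm_of_le _ _ (by simp), Matrix.mul_assoc, hMM, Matrix.mul_one,
      Matrix.charpoly_diagonal]
    simp
  rw [charpoly_discriminant hP hE hR] at hchar
  apply Polynomial.map_injective Complex.ofRealHom Complex.ofReal_injective
  rw [hchar, Polynomial.map_prod]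
  simp

theorem IsEigenbasis.spectralGap_eq (hP : IsMarkovChainOn G P) (hE : IsErgodic P)
    (hR : IsReversible P) (h : IsEigenbasis P ψ lam) (hcard : 1 < Fintype.card V) :
    spectralGap P = 1 - lam ⟨1, hcard⟩ := by
  have hsort : P.charpoly.roots.sort (fun a b => a ≥ b) = List.ofFn lam := by
    have hroots : P.charpoly.roots = (List.ofFn lam : Multiset ℝ) := by
      rw [h.charpoly_eq hP hE hR, Polynomial.roots_prod _ _
        (Finset.prod_ne_zero_iff.2 fun j _ => Polynomial.X_sub_C_ne_zero _)]
      simp [Fin.univ_val_map]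
    rw [hroots, Multiset.coe_sort]
    apply List.mergeSort_of_pairwise
    simp_rw [decide_eq_true_eq]
    exact List.sortedGE_iff_pairwise.1 h.antitone.sortedGE_ofFn
  rw [spectralGap, hsort, List.getD_eq_getElem _ _ (by simpa using hcard), List.getElem_ofFn]

theorem IsEigenbasis.lam_zero (hP : IsMarkovChainOn G P) (hE : IsErgodic P) (hR : IsReversible P)
    (h : IsEigenbasis P ψ lam)
    (hD : ∀ v : V → ℂ, stateNorm (discriminant P *ᵥ v) ≤ stateNorm v)
    {j : Fin (Fintype.card V)} (hj : (j : ℕ) = 0) : lam j = 1 := by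
  obtain ⟨r, hr, hdb⟩ := exists_sqrt_reversing_measure hP hE hR
  have hle (i) : lam i ≤ 1 := (abs_le.1 (h.abs_le_one hD i)).2
  refine le_antisymm (hle j) ?_
  by_contra hlt
  have hne (i) : lam i ≠ 1 := fun hi => hlt (hi ▸ h.antitone (Fin.le_def.2 (by omega)))
  let w : V → ℂ := fun x => (r x : ℂ)
  have hinner (i) : inner ℂ (ψ i) (WithLp.toLp 2 w) = 0 := by
    have h1 : star (ψ i).ofLp ⬝ᵥ w = (lam i : ℂ) * (star (ψ i).ofLp ⬝ᵥ w) := by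
      change _ ⬝ᵥ (fun x => (r x : ℂ)) = _
      have h4 := Matrix.star_mulVec (discriminant P) (ψ i).ofLp
      rw [(discriminant_isHermitian P).eq, h.eigen] at h4
      nth_rewrite 1 [← discriminant_mulVec_sqrt hP hr hdb]
      rw [Matrix.dotProduct_mulVec, ← h4, star_smul, smul_dotProduct]
      simp [w]
    rw [EuclideanSpace.inner_eq_star_dotProduct, dotProduct_comm]
    have h2 : (1 - (lam i : ℂ)) * (star (ψ i).ofLp ⬝ᵥ w) = 0 := by linear_combination h1
    refine (mul_eq_zero.1 h2).resolve_left fun h3 => hne i ?_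
    exact_mod_cast (sub_eq_zero.1 h3).symm
  have hzero : WithLp.toLp 2 w = 0 := by
    rw [← ψ.sum_repr' (WithLp.toLp 2 w)]
    exact Finset.sum_eq_zero fun i _ => by rw [hinner, zero_smul]
  have : Nonempty V := Fintype.card_pos_iff.1 (lt_of_le_of_lt (Nat.zero_le _) j.isLt)
  obtain ⟨x⟩ := this
  have hx : w x = 0 := congrFun ((WithLp.toLp_eq_zero 2).1 hzero) x
  exact (hr x).ne' (Complex.ofReal_eq_zero.1 hx)

theorem IsEigenbasis.lam_one_lt (hP : IsMarkovChainOn G P) (hE : IsErgodic P) (hR : IsReversible P)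
    (h : IsEigenbasis P ψ lam)
    (hD : ∀ v : V → ℂ, stateNorm (discriminant P *ᵥ v) ≤ stateNorm v)
    (hcard : 1 < Fintype.card V) : lam ⟨1, hcard⟩ < 1 := by
  have : Nonempty V := Fintype.card_pos_iff.1 (by omega)
  obtain ⟨r, hr, hdb⟩ := exists_sqrt_reversing_measure hP hE hR
  refine lt_of_le_of_ne (abs_le.1 (h.abs_le_one hD _)).2 fun h1 => ?_
  have h0 : lam ⟨0, by omega⟩ = 1 := h.lam_zero hP hE hR hD rfl
  have e0 := h.eigen ⟨0, by omega⟩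
  have e1 := h.eigen ⟨1, hcard⟩
  rw [h0, Complex.ofReal_one, one_smul] at e0
  rw [h1, Complex.ofReal_one, one_smul] at e1
  obtain ⟨c₀, hc₀⟩ := exists_eq_smul_sqrt_of_discriminant_mulVec_eq hP hE hr hdb e0
  obtain ⟨c₁, hc₁⟩ := exists_eq_smul_sqrt_of_discriminant_mulVec_eq hP hE hr hdb e1
  have hlin : c₁ • ψ ⟨0, by omega⟩ = c₀ • ψ ⟨1, hcard⟩ := by
    apply WithLp.ofLp_injective 2
    rw [WithLp.ofLp_smul, WithLp.ofLp_smul, hc₀, hc₁, smul_comm]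
  have horth : inner ℂ (ψ ⟨0, by omega⟩) (ψ ⟨1, hcard⟩) = 0 :=
    ψ.orthonormal.2 (by simp [Fin.ext_iff])
  have hc : c₁ = 0 := by
    have := congrArg (inner ℂ (ψ ⟨0, by omega⟩)) hlin
    rw [inner_smul_right, inner_smul_right, horth, inner_self_eq_norm_sq_to_K,
      ψ.orthonormal.1] at this
    simpa using this
  have hnorm := stateNorm_orthonormalBasis ψ ⟨1, hcard⟩
  rw [hc₁, hc, zero_smul, stateNorm_zero] at hnorm
  exact zero_ne_one hnorm

end Eigenbasis
end Markov

/-! ### The encoded walk -/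

section Encoding

open Polynomial

variable {V : Type*} [Fintype V] [DecidableEq V] {m : ℕ}

theorem encodeOne_isometry {V : Type*} [DecidableEq V] {m : ℕ} (enc : V ↪ Bits m) : (encodeOne enc)ᴴ * encodeOne enc = 1 := by
  ext x y
  simp [encodeOne, Matrix.mul_apply, Matrix.one_apply, enc.injective.eq_iff, eq_comm]

theorem encodeOne_mulVec_apply (enc : V ↪ Bits m) (z : V → ℂ) (x : V) :
    (encodeOne enc *ᵥ z) (enc x) = z x := by
  simp [encodeOne, Matrix.mulVec, dotProduct, enc.injective.eq_iff]

theorem tensorRight_mul_encodeOne (enc : V ↪ Bits m) (z : V → ℂ) :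
    tensorRight (Bits m) (encodeOne enc *ᵥ z) * encodeOne enc
      = encodeTwo enc * tensorRight V z := by
  apply Matrix.mulVec_injective
  funext v
  simp only [← Matrix.mulVec_mulVec, tensorRight_mulVec, encodeTwo, kronecker_mulVec_tensor]

theorem tensorRight_conjTranspose_mul_encodeTwo (enc : V ↪ Bits m) (z : V → ℂ) :
    (tensorRight (Bits m) (encodeOne enc *ᵥ z))ᴴ * encodeTwo enc
      = encodeOne enc * (tensorRight V z)ᴴ := by
  ext b ⟨x, y⟩
  have hl : ((tensorRight (Bits m) (encodeOne enc *ᵥ z))ᴴ * encodeTwo enc) b (x, y)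
      = ((tensorRight (Bits m) (encodeOne enc *ᵥ z))ᴴ *ᵥ fun p => encodeTwo enc p (x, y)) b := rfl
  rw [hl, tensorRight_conjTranspose_mulVec, Matrix.mul_apply, Finset.sum_eq_single (enc y),
    Finset.sum_eq_single x, encodeOne_mulVec_apply]
  · simp [encodeTwo, encodeOne, tensorRight, mul_comm]
  · intro x' _ hx
    simp [tensorRight, Ne.symm hx]
  · simp
  · intro b' _ hb
    simp [encodeTwo, encodeOne, hb]
  · simp

variable {G : SimpleGraph V} {P : Matrix V V ℝ} {z : V → ℂ} {U : Matrix (V × V) (V × V) ℂ}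
  {enc : V ↪ Bits m} {W : Matrix (Bits m × Bits m) (Bits m × Bits m) ℂ}

/-- On the qubits, too, the powers of the walk compressed to `|0̄⟩` are the Chebyshev polynomials of
the discriminant. -/
theorem compression_encoded_walk_pow (hP : IsMarkovChainOn G P) (hz : stateNorm z = 1)
    (hU : IsStatePreparation P z U) (hW : Implements enc (walkOperator G z U) W) (l : ℕ) :
    (tensorRight (Bits m) (encodeOne enc *ᵥ z))ᴴ * W ^ l *
        tensorRight (Bits m) (encodeOne enc *ᵥ z) * encodeOne enc
      = encodeOne enc * aeval (discriminant P) (Chebyshev.T ℂ (l : ℤ)) := by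
  have hpow : W ^ l * encodeTwo enc = encodeTwo enc * walkOperator G z U ^ l := by
    induction l with
    | zero => simp
    | succ l ih =>
      rw [pow_succ, Matrix.mul_assoc, hW.intertwines, ← Matrix.mul_assoc, ih, Matrix.mul_assoc,
        ← pow_succ]
  rw [Matrix.mul_assoc, tensorRight_mul_encodeOne, ← Matrix.mul_assoc,
    Matrix.mul_assoc _ (W ^ l), hpow, ← Matrix.mul_assoc, tensorRight_conjTranspose_mul_encodeTwo,
    Matrix.mul_assoc (encodeOne enc), Matrix.mul_assoc (encodeOne enc),
    compression_walk_pow hP hz hU]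

/-- The adjoint of an isometry is a contraction. -/
theorem stateNorm_conjTranspose_mulVec_le {ι κ : Type*} [Fintype ι] [Fintype κ] [DecidableEq κ]
    {K : Matrix ι κ ℂ} (hK : Kᴴ * K = 1) (w : ι → ℂ) : stateNorm (Kᴴ *ᵥ w) ≤ stateNorm w := by
  -- Pythagoras: `‖w‖² = ‖w - K Kᴴ w‖² + ‖Kᴴ w‖²`
  have h1 : star w ⬝ᵥ (K *ᵥ (Kᴴ *ᵥ w)) = star (Kᴴ *ᵥ w) ⬝ᵥ (Kᴴ *ᵥ w) := by
    rw [Matrix.dotProduct_mulVec, Matrix.star_mulVec, Matrix.conjTranspose_conjTranspose]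
  have h2 : star (K *ᵥ (Kᴴ *ᵥ w)) ⬝ᵥ w = star (Kᴴ *ᵥ w) ⬝ᵥ (Kᴴ *ᵥ w) := by
    rw [Matrix.star_mulVec, ← Matrix.dotProduct_mulVec]
  have h3 : star (K *ᵥ (Kᴴ *ᵥ w)) ⬝ᵥ (K *ᵥ (Kᴴ *ᵥ w)) = star (Kᴴ *ᵥ w) ⬝ᵥ (Kᴴ *ᵥ w) := by
    rw [← stateNorm_sq_eq_dotProduct, stateNorm_mulVec_of_isometry hK, stateNorm_sq_eq_dotProduct]
  have h4 : stateNorm (w - K *ᵥ (Kᴴ *ᵥ w)) ^ 2 = stateNorm w ^ 2 - stateNorm (Kᴴ *ᵥ w) ^ 2 := by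
    apply Complex.ofReal_injective
    rw [Complex.ofReal_sub, stateNorm_sq_eq_dotProduct, stateNorm_sq_eq_dotProduct,
      stateNorm_sq_eq_dotProduct, star_sub, sub_dotProduct, dotProduct_sub, dotProduct_sub, h1, h2,
      h3]
    ring
  have h5 := sq_nonneg (stateNorm (w - K *ᵥ (Kᴴ *ᵥ w)))
  exact (sq_le_sq₀ (stateNorm_nonneg _) (stateNorm_nonneg _)).1 (by linarith)

theorem stateNorm_encodeOne_mulVec (enc : V ↪ Bits m) (v : V → ℂ) :
    stateNorm (encodeOne enc *ᵥ v) = stateNorm v :=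
  stateNorm_mulVec_of_isometry (encodeOne_isometry enc) v

/-- The operators `T_l(D)` are contractions, being compressions of unitaries. -/
theorem stateNorm_aeval_T_le (hP : IsMarkovChainOn G P) (hz : stateNorm z = 1)
    (hU : IsStatePreparation P z U) (hW : Implements enc (walkOperator G z U) W) (l : ℕ)
    (v : V → ℂ) :
    stateNorm (aeval (discriminant P) (Chebyshev.T ℂ (l : ℤ)) *ᵥ v) ≤ stateNorm v := by
  have hK := tensorRight_isometry (α := Bits m)
    ((stateNorm_encodeOne_mulVec enc z).trans hz)
  rw [← stateNorm_encodeOne_mulVec enc, Matrix.mulVec_mulVec,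
    ← compression_encoded_walk_pow hP hz hU hW, ← Matrix.mulVec_mulVec, ← Matrix.mulVec_mulVec,
    ← Matrix.mulVec_mulVec]
  refine (stateNorm_conjTranspose_mulVec_le hK _).trans ?_
  rw [stateNorm_mulVec_of_unitary (pow_mem hW.unitary l), stateNorm_mulVec_of_isometry hK,
    stateNorm_encodeOne_mulVec]

theorem stateNorm_discriminant_mulVec_le (hP : IsMarkovChainOn G P) (hz : stateNorm z = 1)
    (hU : IsStatePreparation P z U) (hW : Implements enc (walkOperator G z U) W) (v : V → ℂ) :
    stateNorm (discriminant P *ᵥ v) ≤ stateNorm v := by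
  simpa using stateNorm_aeval_T_le hP hz hU hW 1 v

end Encoding

/-! ### Truncated Chebyshev mixtures -/

section Mixture

open Polynomial

/-- The degree `|k - t|` of the Chebyshev polynomial belonging to `k` heads, replaced by `0` if it
is `N` or more and so has no label among `0, …, N - 1`. -/
def truncatedDegree (t N k : ℕ) : ℕ :=
  if ((k : ℤ) - t).natAbs < N then ((k : ℤ) - t).natAbs else 0

theorem truncatedDegree_lt (t k : ℕ) {N : ℕ} (hN : 0 < N) : truncatedDegree t N k < N := by
  unfold truncatedDegree
  split_ifs with h
  exacts [h, hN]

/-- The distribution of the truncated degree. -/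
def degreeWeight (t N l : ℕ) : ℝ :=
  ∑ k ∈ Finset.range (2 * t + 1) with truncatedDegree t N k = l, binomialWeight t k

theorem degreeWeight_nonneg (t N l : ℕ) : 0 ≤ degreeWeight t N l :=
  Finset.sum_nonneg fun _ _ => binomialWeight_nonneg _ _

theorem sum_degreeWeight_smul {M : Type*} [AddCommGroup M] [Module ℂ M] (t τ : ℕ) (f : ℕ → M) :
    ∑ l : Bits τ, (degreeWeight t (2 ^ τ) (bitsEquiv τ l) : ℂ) • f (bitsEquiv τ l)
      = ∑ k ∈ Finset.range (2 * t + 1),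
          (binomialWeight t k : ℂ) • f (truncatedDegree t (2 ^ τ) k) := by
  rw [(bitsEquiv τ).sum_comp fun l : Fin (2 ^ τ) => (degreeWeight t (2 ^ τ) l : ℂ) • f l,
    Fin.sum_univ_eq_sum_range fun l => (degreeWeight t (2 ^ τ) l : ℂ) • f l,
    ← Finset.sum_fiberwise_of_maps_to (s := Finset.range (2 * t + 1))
      (g := truncatedDegree t (2 ^ τ)) (t := Finset.range (2 ^ τ)) fun k _ =>
        Finset.mem_range.2 (truncatedDegree_lt t k (by positivity))]
  refine Finset.sum_congr rfl fun l _ => ?_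
  rw [degreeWeight, Complex.ofReal_sum, Finset.sum_smul]
  refine Finset.sum_congr rfl fun k hk => ?_
  rw [(Finset.mem_filter.1 hk).2]

/-- A unitary that prepares the superposition of all labels with the square roots of the weights as
amplitudes. -/
theorem exists_unitary_degreeWeight (t τ : ℕ) :
    ∃ Vq ∈ Matrix.unitaryGroup (Bits τ) ℂ, ∃ s : Bits τ → ℂ, Vq *ᵥ zeroKet τ = s ∧
      ∀ l, star (s l) * s l = (degreeWeight t (2 ^ τ) (bitsEquiv τ l) : ℂ) := by
  set s : Bits τ → ℂ := fun l => ((√(degreeWeight t (2 ^ τ) (bitsEquiv τ l)) : ℝ) : ℂ) with hs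
  have hsl (l : Bits τ) : star (s l) * s l = (degreeWeight t (2 ^ τ) (bitsEquiv τ l) : ℂ) := by
    rw [hs]
    simp only [Complex.star_def, Complex.conj_ofReal]
    rw [← Complex.ofReal_mul, Real.mul_self_sqrt (degreeWeight_nonneg _ _ _)]
  have hnorm : stateNorm s = 1 := by
    have h : ((stateNorm s ^ 2 : ℝ) : ℂ) = 1 := by
      rw [stateNorm_sq_eq_dotProduct, dotProduct]
      simp only [Pi.star_apply, hsl]
      have := sum_degreeWeight_smul t τ fun _ => (1 : ℂ)
      simp only [smul_eq_mul, mul_one] at this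
      rw [this, ← Complex.ofReal_sum, sum_binomialWeight, Complex.ofReal_one]
    have h' : stateNorm s ^ 2 = 1 := by exact_mod_cast h
    exact (pow_eq_one_iff_of_nonneg (stateNorm_nonneg s) two_ne_zero).1 h'
  obtain ⟨Vq, hV, hVs⟩ := exists_unitary_mulVec_single (fun _ : Fin τ => false) hnorm
  exact ⟨Vq, hV, s, hVs, hsl⟩

variable {V : Type*} [Fintype V] [DecidableEq V]

/-- The Chebyshev expansion of the `t`-th power of `(1 + D) / 2`, in which the terms of degree `N` or
more are replaced by constants. -/
def truncatedPower (t N : ℕ) (D : Matrix V V ℂ) : Matrix V V ℂ :=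
  ∑ k ∈ Finset.range (2 * t + 1),
    (binomialWeight t k : ℂ) • aeval D (Chebyshev.T ℂ (truncatedDegree t N k : ℤ))

/-- Only the terms in the tail of the binomial distribution contribute to the error, each of them
at most twice its weight. -/
theorem stateNorm_truncatedPower_sub_le {D : Matrix V V ℂ} {v : V → ℂ} (hv : stateNorm v = 1)
    (hT : ∀ l : ℕ, stateNorm (aeval D (Chebyshev.T ℂ (l : ℤ)) *ᵥ v) ≤ stateNorm v)
    {t : ℕ} (ht : 0 < t) (N : ℕ) :
    stateNorm (truncatedPower t N D *ᵥ v - ((1 / 2 : ℂ) • (1 + D)) ^ t *ᵥ v)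
      ≤ 4 * Real.exp (-((N : ℝ) ^ 2 / t)) := by
  rw [aeval_T_expansion, truncatedPower, ← Matrix.sub_mulVec, ← Finset.sum_sub_distrib,
    Matrix.sum_mulVec]
  refine (stateNorm_sum_le _ _).trans ?_
  have hterm (k : ℕ) : stateNorm (((binomialWeight t k : ℂ) •
        aeval D (Chebyshev.T ℂ (truncatedDegree t N k : ℤ))
        - (binomialWeight t k : ℂ) • aeval D (Chebyshev.T ℂ ((k : ℤ) - t))) *ᵥ v)
      ≤ if (N : ℝ) ≤ |((k : ℕ) : ℝ) - t| then 2 * binomialWeight t k else 0 := by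
    rw [← Chebyshev.T_natAbs ℂ ((k : ℤ) - t)]
    have habs : (((k : ℤ) - t).natAbs : ℝ) = |((k : ℕ) : ℝ) - t| := by
      rw [Nat.cast_natAbs]; push_cast; rfl
    by_cases h : ((k : ℤ) - t).natAbs < N
    · rw [truncatedDegree, if_pos h, sub_self, Matrix.zero_mulVec, stateNorm_zero]
      have := binomialWeight_nonneg t k
      split_ifs <;> positivity
    · rw [if_pos (by rw [← habs]; exact_mod_cast not_lt.1 h), ← smul_sub, Matrix.smul_mulVec,
        stateNorm_smul, Complex.norm_real, Real.norm_of_nonneg (binomialWeight_nonneg t k),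
        Matrix.sub_mulVec, mul_comm]
      refine mul_le_mul_of_nonneg_right ?_ (binomialWeight_nonneg t k)
      refine (stateNorm_sub_le _ _).trans ?_
      linarith [hT (truncatedDegree t N k), hT ((k : ℤ) - t).natAbs]
  refine (Finset.sum_le_sum fun k _ => hterm k).trans ?_
  rw [← Finset.sum_filter, ← Finset.mul_sum]
  linarith [sum_binomialWeight_tail_le ht (Nat.cast_nonneg (α := ℝ) N)]

theorem aeval_mulVec_of_eigenvector {D : Matrix V V ℂ} {v : V → ℂ} {c : ℂ} (h : D *ᵥ v = c • v)
    (p : ℂ[X]) : aeval D p *ᵥ v = p.eval c • v := by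
  induction p using Polynomial.induction_on' with
  | add p q hp hq => rw [map_add, Matrix.add_mulVec, hp, hq, eval_add, add_smul]
  | monomial n a =>
    have hpow : D ^ n *ᵥ v = c ^ n • v := by
      induction n with
      | zero => simp
      | succ n ih =>
        rw [pow_succ, ← Matrix.mulVec_mulVec, h, Matrix.mulVec_smul, ih, smul_smul, pow_succ']
    rw [aeval_monomial, eval_monomial, ← Matrix.mulVec_mulVec, hpow, Matrix.mulVec_smul,
      Algebra.algebraMap_eq_smul_one, Matrix.smul_mulVec, Matrix.one_mulVec, smul_smul, mul_comm]

theorem truncatedPower_mulVec_of_fixed {D : Matrix V V ℂ} {v : V → ℂ} (h : D *ᵥ v = v) (t N : ℕ) :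
    truncatedPower t N D *ᵥ v = v := by
  have h1 : D *ᵥ v = (1 : ℂ) • v := by rw [h, one_smul]
  simp only [truncatedPower, Matrix.sum_mulVec, Matrix.smul_mulVec, aeval_mulVec_of_eigenvector h1,
    Chebyshev.T_eval_one, one_smul]
  rw [← Finset.sum_smul, ← Complex.ofReal_sum, sum_binomialWeight, Complex.ofReal_one, one_smul]

theorem discriminant_lazyChain {V : Type*} [DecidableEq V] {P : Matrix V V ℝ} (hP : ∀ x y, 0 ≤ P x y) :
    discriminant (lazyChain P) = (1 / 2 : ℂ) • (1 + discriminant P) := by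
  ext x y
  by_cases hxy : x = y
  · subst hxy
    have h := hP x x
    simp only [discriminant, lazyChain, Matrix.of_apply, Matrix.smul_apply, Matrix.add_apply,
      Matrix.one_apply_eq, smul_eq_mul]
    rw [Real.sqrt_mul_self (by positivity), Real.sqrt_mul_self h]
    push_cast
    ring
  · simp only [discriminant, lazyChain, Matrix.of_apply, Matrix.smul_apply, Matrix.add_apply,
      Matrix.one_apply_ne hxy, Matrix.one_apply_ne (Ne.symm hxy), smul_eq_mul, zero_add]
    rw [show (1 / 2 * P x y * (1 / 2 * P y x) : ℝ) = (1 / 2) ^ 2 * (P x y * P y x) by ring,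
      Real.sqrt_mul (by positivity), Real.sqrt_sq (by norm_num)]
    push_cast
    ring

end Mixture

/-! ### The encoded circuits -/

section EncodedCircuits

open Polynomial

variable {V : Type*} [Fintype V] [DecidableEq V] {m τ : ℕ}
variable {G : SimpleGraph V} {P : Matrix V V ℝ} {z : V → ℂ} {U : Matrix (V × V) (V × V) ℂ}
  {enc : V ↪ Bits m} {W : Matrix (Bits m × Bits m) (Bits m × Bits m) ℂ}
  {Vq : Matrix (Bits τ) (Bits τ) ℂ} {s : Bits τ → ℂ} {t : ℕ}

theorem zeroProjection_fastForward_encoded (hP : IsMarkovChainOn G P) (hz : stateNorm z = 1)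
    (hU : IsStatePreparation P z U) (hW : Implements enc (walkOperator G z U) W)
    (hs : Vq *ᵥ zeroKet τ = s)
    (hsl : ∀ l, star (s l) * s l = (degreeWeight t (2 ^ τ) (bitsEquiv τ l) : ℂ)) (v : V → ℂ)
    (b : Bool) :
    zeroProjection τ (encodeOne enc *ᵥ z) *ᵥ (Circuit.eval W (fastForward m Vq) *ᵥ
        registerState τ (encodeOne enc *ᵥ z) (encodeOne enc *ᵥ v) b)
      = registerState τ (encodeOne enc *ᵥ z)
          (encodeOne enc *ᵥ (truncatedPower t (2 ^ τ) (discriminant P) *ᵥ v)) b := by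
  rw [zeroProjection_fastForward_mulVec W hs, Matrix.mulVec_mulVec, Matrix.mulVec_mulVec]
  congr 2
  simp only [hsl]
  rw [Matrix.sum_mul]
  simp only [Matrix.smul_mul, compression_encoded_walk_pow hP hz hU hW]
  rw [truncatedPower, ← sum_degreeWeight_smul t τ fun l =>
    aeval (discriminant P) (Chebyshev.T ℂ (l : ℤ)), Matrix.mul_sum]
  simp only [Matrix.mul_smul]

/-- The failure of the circuit to act as the identity is governed by what the fast-forwarding
circuit leaves in the block selected by `|0̄⟩|0^τ⟩`. -/
theorem stateNorm_reflection_sub_one (hP : IsMarkovChainOn G P) (hz : stateNorm z = 1)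
    (hU : IsStatePreparation P z U) (hW : Implements enc (walkOperator G z U) W)
    (hV : Vq ∈ Matrix.unitaryGroup (Bits τ) ℂ) (hs : Vq *ᵥ zeroKet τ = s)
    (hsl : ∀ l, star (s l) * s l = (degreeWeight t (2 ^ τ) (bitsEquiv τ l) : ℂ)) (v : V → ℂ) :
    stateNorm ((Circuit.eval W (reflectionCircuit (encodeOne enc *ᵥ z) Vq) - 1) *ᵥ
        inputState τ enc z v)
      = 2 * stateNorm (truncatedPower t (2 ^ τ) (discriminant P) *ᵥ v) := by
  have hz' : stateNorm (encodeOne enc *ᵥ z) = 1 := (stateNorm_encodeOne_mulVec enc z).trans hz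
  have hA : (Circuit.eval W (fastForward m Vq))ᴴ ∈ Matrix.unitaryGroup (Basis m τ) ℂ :=
    Unitary.star_mem (Circuit.eval_mem_unitaryGroup hW.unitary (fastForward_isUnitary hV))
  change stateNorm (_ *ᵥ registerState τ (encodeOne enc *ᵥ z) (encodeOne enc *ᵥ v) false) = _
  rw [Matrix.sub_mulVec, Matrix.one_mulVec, eval_reflectionCircuit_mulVec W hW.unitary hV hz',
    zeroProjection_fastForward_encoded hP hz hU hW hs hsl, sub_sub_cancel_left, stateNorm_neg,
    stateNorm_smul,
    stateNorm_mulVec_of_unitary (Gate.eval_mem_unitaryGroup hW.unitary (ccX_isUnitary hz')),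
    stateNorm_mulVec_of_unitary hA, stateNorm_registerState hz',
    stateNorm_encodeOne_mulVec]
  simp

/-- A fixed vector of the discriminant is exactly reflected: the fast-forwarding circuit fixes it. -/
theorem reflection_add_one_mulVec_of_fixed (hP : IsMarkovChainOn G P) (hz : stateNorm z = 1)
    (hU : IsStatePreparation P z U) (hW : Implements enc (walkOperator G z U) W)
    (hV : Vq ∈ Matrix.unitaryGroup (Bits τ) ℂ) (hs : Vq *ᵥ zeroKet τ = s)
    (hsl : ∀ l, star (s l) * s l = (degreeWeight t (2 ^ τ) (bitsEquiv τ l) : ℂ)) {v : V → ℂ}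
    (hv : discriminant P *ᵥ v = v) :
    (Circuit.eval W (reflectionCircuit (encodeOne enc *ᵥ z) Vq) + 1) *ᵥ inputState τ enc z v
      = 0 := by
  have hz' : stateNorm (encodeOne enc *ᵥ z) = 1 := (stateNorm_encodeOne_mulVec enc z).trans hz
  have hA := Circuit.eval_mem_unitaryGroup hW.unitary (fastForward_isUnitary (m := m) hV)
  have hproj := zeroProjection_fastForward_encoded hP hz hU hW hs hsl v true
  rw [truncatedPower_mulVec_of_fixed hv] at hproj
  have hfix := unitary_mulVec_eq_self_of_projection hA (zeroProjection_conjTranspose _)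
    (zeroProjection_mulVec_registerState hz' _ _) hproj
  have hfix' : (Circuit.eval W (fastForward m Vq))ᴴ *ᵥ
      registerState τ (encodeOne enc *ᵥ z) (encodeOne enc *ᵥ v) true
      = registerState τ (encodeOne enc *ᵥ z) (encodeOne enc *ᵥ v) true := by
    nth_rewrite 1 [← hfix]
    rw [Matrix.mulVec_mulVec, conjTranspose_mul_self_of_mem_unitaryGroup hA, Matrix.one_mulVec]
  change _ *ᵥ registerState τ (encodeOne enc *ᵥ z) (encodeOne enc *ᵥ v) false = _
  rw [Matrix.add_mulVec, Matrix.one_mulVec, eval_reflectionCircuit_mulVec W hW.unitary hV hz',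
    hproj, hfix', eval_ccX_mulVec_registerState W hz', Bool.not_true, two_smul]
  abel

end EncodedCircuits

/-! ### Choice of the parameters -/

section Parameters

theorem exists_two_pow_between {y : ℝ} (hy : 1 ≤ y) : ∃ τ : ℕ, y ≤ 2 ^ τ ∧ (2 : ℝ) ^ τ ≤ 2 * y := by
  obtain ⟨n, h1, h2⟩ := exists_nat_pow_near hy one_lt_two
  exact ⟨n + 1, h2.le, by rw [pow_succ]; linarith⟩

/-- The number `t` of steps is `⌈2L/δ⌉` and the number `2^τ` of labels lies between `3L/√δ` and
`6L/√δ`, where `L = log (4/ε)`. The hypothesis `δ ≤ 2` keeps these quantities away from `0`, so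
that rounding is absorbed by the constant `12`, which is not optimized. -/
theorem exists_parameters {δ ε : ℝ} (hδ : 0 < δ) (hδ2 : δ ≤ 2) (hε : 0 < ε) (hε1 : ε < 1) :
    ∃ τ t : ℕ, 0 < t ∧
      (Real.log (4 / ε) / δ ≤ t ∧ (t : ℝ) ≤ 12 * (Real.log (4 / ε) / δ)) ∧
      4 * Real.exp (-(((2 ^ τ : ℕ) : ℝ) ^ 2 / t)) ≤ ε / 4 ∧
      (1 - δ / 2) ^ t ≤ ε / 4 ∧
      (Real.log (4 / ε) / √δ ≤ ((2 * (2 ^ τ - 1) : ℕ) : ℝ) ∧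
        ((2 * (2 ^ τ - 1) : ℕ) : ℝ) ≤ 12 * (Real.log (4 / ε) / √δ)) ∧
      (Real.log (2 / √δ) + Real.log (Real.log (4 / ε)) ≤ ((τ + 1 : ℕ) : ℝ) ∧
        ((τ + 1 : ℕ) : ℝ) ≤ 12 * (Real.log (2 / √δ) + Real.log (Real.log (4 / ε)))) := by
  set L := Real.log (4 / ε) with hL
  have hlog2 := Real.log_two_gt_d9
  have hlog2' := Real.log_two_lt_d9
  have hlog4 : Real.log 4 = 2 * Real.log 2 := by
    rw [show (4 : ℝ) = 2 ^ 2 by norm_num, Real.log_pow]; norm_num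
  have hL4 : Real.log 4 ≤ L := Real.log_le_log (by norm_num) (by rw [le_div_iff₀ hε]; linarith)
  have hL0 : 1.386 ≤ L := by linarith
  have hexpL : Real.exp (-L) = ε / 4 := by
    rw [hL, Real.exp_neg, Real.exp_log (by positivity), inv_div]
  have hsq : √δ ^ 2 = δ := Real.sq_sqrt hδ.le
  have hs0 : 0 < √δ := Real.sqrt_pos.2 hδ
  have hs2 : √δ ≤ 1.415 := by
    rw [Real.sqrt_le_left (by norm_num)]; norm_num; linarith
  -- `Y` is the argument of the logarithm that counts the qubits
  set Y := 2 * L / √δ with hY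
  have hY1 : 1.95 ≤ Y := by rw [hY, le_div_iff₀ hs0]; linarith
  obtain ⟨τ, hτ1, hτ2⟩ := exists_two_pow_between (y := 3 * L / √δ)
    (by rw [le_div_iff₀ hs0]; linarith)
  have hLs : L / √δ = Y / 2 := by rw [hY]; ring
  have h3 : 3 * L / √δ = 3 * (Y / 2) := by rw [hY]; ring
  rw [h3] at hτ1 hτ2
  set N : ℝ := 2 ^ τ with hN
  have hLd : 1 ≤ 2 * L / δ := by rw [le_div_iff₀ hδ]; linarith
  have hLd' : L / δ = (2 * L / δ) / 2 := by ring
  refine ⟨τ, ⌈2 * L / δ⌉₊, Nat.ceil_pos.2 (by linarith), ?_⟩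
  set t := ⌈2 * L / δ⌉₊ with ht
  have ht1 : 2 * L / δ ≤ t := Nat.le_ceil _
  have ht2 : (t : ℝ) < 2 * L / δ + 1 := Nat.ceil_lt_add_one (by linarith)
  have ht0 : (0 : ℝ) < t := by linarith
  have hcalls : ((2 * (2 ^ τ - 1) : ℕ) : ℝ) = 2 * (N - 1) := by
    rw [Nat.cast_mul, Nat.cast_sub Nat.one_le_two_pow]; push_cast; rfl
  have hlogs : Real.log (2 / √δ) + Real.log L = Real.log Y := by
    rw [← Real.log_mul (by positivity) (by linarith), hY]
    congr 1; ring
  have hlogN : Real.log N = τ * Real.log 2 := by rw [hN, Real.log_pow]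
  have hlogY : 1 / 2 ≤ Real.log Y := by
    rw [Real.le_log_iff_exp_le (by linarith)]
    have h1 : Real.exp (1 / 2) ^ 2 = Real.exp 1 := by
      rw [← Real.exp_nat_mul]; norm_num
    have h2 := Real.exp_one_lt_d9
    have h3 : Real.exp (1 / 2) ≤ 1.95 := by
      refine le_of_sq_le_sq ?_ (by norm_num)
      rw [h1]; norm_num; linarith
    linarith
  refine ⟨⟨by linarith, by linarith⟩, ?_, ?_, ?_, ?_⟩
  · have hkey : 2 * L ≤ N ^ 2 / t := by
      rw [le_div_iff₀ ht0]
      have h1 : (3 * (Y / 2)) ^ 2 ≤ N ^ 2 := by gcongr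
      have h2 : (3 * (Y / 2)) ^ 2 = 9 / 2 * L * (2 * L / δ) := by
        rw [hY]
        have : (3 * (2 * L / √δ / 2)) ^ 2 = 9 * L ^ 2 / √δ ^ 2 := by ring
        rw [this, hsq]; ring
      have h3 : 2 * L * t ≤ 2 * L * (2 * (2 * L / δ)) := by gcongr; linarith
      nlinarith [mul_nonneg (by linarith : (0 : ℝ) ≤ L) (by linarith : (0 : ℝ) ≤ 2 * L / δ)]
    have hcast : ((2 ^ τ : ℕ) : ℝ) = N := by push_cast; rfl
    rw [hcast]
    calc 4 * Real.exp (-(N ^ 2 / t)) ≤ Real.exp L * Real.exp (-(2 * L)) := by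
          gcongr
          rw [← Real.log_le_iff_le_exp (by norm_num)]
          exact hL4
      _ = ε / 4 := by rw [← Real.exp_add, ← hexpL]; congr 1; ring
  · rw [← hexpL]
    calc (1 - δ / 2) ^ t ≤ Real.exp (-(δ / 2)) ^ t := by
          gcongr
          · linarith
          · linarith [Real.add_one_le_exp (-(δ / 2))]
      _ = Real.exp (-(δ / 2 * t)) := by rw [← Real.exp_nat_mul]; congr 1; ring
      _ ≤ Real.exp (-L) := by
          rw [div_le_iff₀ hδ] at ht1
          gcongr
          linarith
  · rw [hcalls, hLs]
    constructor <;> linarith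
  · rw [hlogs]
    push_cast
    constructor
    · have : Real.log Y ≤ Real.log N := Real.log_le_log (by linarith) (by linarith)
      have hτ0 : (0 : ℝ) ≤ τ := Nat.cast_nonneg τ
      nlinarith
    · have h1 : Real.log N ≤ Real.log 4 + Real.log Y := by
        rw [← Real.log_mul (by norm_num) (by linarith)]
        exact Real.log_le_log (by positivity) (by linarith)
      have hτ0 : (0 : ℝ) ≤ τ := Nat.cast_nonneg τ
      nlinarith

end Parameters

/-! ### The approximate reflection -/

theorem mainTheorem3 :
    ∃ c C : ℝ, 0 < c ∧ 0 < C ∧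
      ∀ δ ε₂ : ℝ, 0 < ε₂ → ε₂ < 1 →
      ∃ (τ t : ℕ) (Vq : Matrix (Bits τ) (Bits τ) ℂ),
        Vq ∈ Matrix.unitaryGroup (Bits τ) ℂ ∧
        ∀ (V : Type*) [Fintype V] [DecidableEq V] [Nontrivial V] (G : SimpleGraph V)
          (P : Matrix V V ℝ) (z : V → ℂ) (U : Matrix (V × V) (V × V) ℂ)
          (enc : V ↪ Bits (Nat.clog 2 (Fintype.card V)))
          (W : Matrix (Bits (Nat.clog 2 (Fintype.card V)) × Bits (Nat.clog 2 (Fintype.card V)))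
            (Bits (Nat.clog 2 (Fintype.card V)) × Bits (Nat.clog 2 (Fintype.card V))) ℂ),
          IsMarkovChainOn G P → IsErgodic P → IsReversible P → spectralGap P = δ →
          stateNorm z = 1 → IsStatePreparation P z U →
          Implements enc (walkOperator G z U) W →
          0 < δ ∧
          -- the fast-forwarding circuit simulates `t` steps of the lazy chain
          (c * (Real.log (4 / ε₂) / δ) ≤ t ∧ (t : ℝ) ≤ C * (Real.log (4 / ε₂) / δ)) ∧
          (∀ v : V → ℂ, stateNorm v = 1 →
            stateNorm
              (zeroProjection τ (encodeOne enc *ᵥ z) *ᵥ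
                  ((fastForward _ Vq).eval W *ᵥ inputState τ enc z v)
                - inputState τ enc z ((discriminant (lazyChain P) ^ t) *ᵥ v)) ≤ ε₂ / 4) ∧
          -- the circuit of the approximate reflection and its cost
          (∀ g ∈ reflectionCircuit (encodeOne enc *ᵥ z) Vq, g.IsUnitary) ∧
          (c * (Real.log (4 / ε₂) / √δ)
              ≤ (Circuit.calls (reflectionCircuit (encodeOne enc *ᵥ z) Vq) : ℝ) ∧
            (Circuit.calls (reflectionCircuit (encodeOne enc *ᵥ z) Vq) : ℝ)
              ≤ C * (Real.log (4 / ε₂) / √δ)) ∧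
          (∃ a : ℕ,
            Circuit.numQubits (reflectionCircuit (encodeOne enc *ᵥ z) Vq)
              = 2 * Nat.clog 2 (Fintype.card V) + a ∧
            c * (Real.log (2 / √δ) + Real.log (Real.log (4 / ε₂))) ≤ a ∧
            (a : ℝ) ≤ C * (Real.log (2 / √δ) + Real.log (Real.log (4 / ε₂)))) ∧
          -- its action on the eigenvectors of the discriminant
          ∀ (ψ : OrthonormalBasis (Fin (Fintype.card V)) ℂ (EuclideanSpace ℂ V))
            (lam : Fin (Fintype.card V) → ℝ), IsEigenbasis P ψ lam →
            ∀ j : Fin (Fintype.card V),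
              ((j : ℕ) = 0 → lam j = 1 ∧
                stateNorm
                  (((reflectionCircuit (encodeOne enc *ᵥ z) Vq).eval W + 1) *ᵥ
                    inputState τ enc z (ψ j).ofLp) ^ 2 = 0) ∧
              ((j : ℕ) ≠ 0 →
                stateNorm
                  (((reflectionCircuit (encodeOne enc *ᵥ z) Vq).eval W - 1) *ᵥ
                    inputState τ enc z (ψ j).ofLp) ^ 2 ≤ ε₂) := by
  refine ⟨1, 12, one_pos, by norm_num, fun δ ε₂ hε hε1 => ?_⟩
  by_cases hδ : 0 < δ ∧ δ ≤ 2
  · obtain ⟨τ, t, ht0, ht, hexp, hpow, hcalls, hqubits⟩ := exists_parameters hδ.1 hδ.2 hε hε1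
    obtain ⟨Vq, hV, s, hs, hsl⟩ := exists_unitary_degreeWeight t τ
    refine ⟨τ, t, Vq, hV, ?_⟩
    intro V _ _ _ G P z U enc W hP hE hR hgap hz hU hW
    have hz' : stateNorm (encodeOne enc *ᵥ z) = 1 := (stateNorm_encodeOne_mulVec enc z).trans hz
    have hD := stateNorm_discriminant_mulVec_le hP hz hU hW
    have herr (v : V → ℂ) (hv : stateNorm v = 1) :
        stateNorm (truncatedPower t (2 ^ τ) (discriminant P) *ᵥ v
          - discriminant (lazyChain P) ^ t *ᵥ v) ≤ ε₂ / 4 := by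
      rw [discriminant_lazyChain hP.nonneg]
      exact (stateNorm_truncatedPower_sub_le hv
        (fun l => stateNorm_aeval_T_le hP hz hU hW l v) ht0 _).trans hexp
    refine ⟨hδ.1, ⟨by linarith [ht.1], ht.2⟩, fun v hv => ?_, reflectionCircuit_isUnitary hz' hV,
      ?_, ⟨τ + 1, ?_, by linarith [hqubits.1], hqubits.2⟩, ?_⟩
    · change stateNorm (zeroProjection τ _ *ᵥ (_ *ᵥ
        registerState τ (encodeOne enc *ᵥ z) (encodeOne enc *ᵥ v) false)
          - registerState τ (encodeOne enc *ᵥ z) (encodeOne enc *ᵥ _) false) ≤ _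
      rw [zeroProjection_fastForward_encoded hP hz hU hW hs hsl, registerState, registerState,
        ← tensor_sub_left, ← Matrix.mulVec_sub]
      change stateNorm (registerState τ _ _ false) ≤ _
      rw [stateNorm_registerState hz', stateNorm_encodeOne_mulVec]
      exact herr v hv
    · rw [calls_reflectionCircuit]
      exact ⟨by linarith [hcalls.1], hcalls.2⟩
    · rw [Circuit.numQubits]
      ring
    · intro ψ lam hψ j
      refine ⟨fun hj => ?_, fun hj => ?_⟩
      · have hlam := hψ.lam_zero hP hE hR hD hj
        have hfix : discriminant P *ᵥ (ψ j).ofLp = (ψ j).ofLp := by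
          rw [hψ.eigen, hlam, Complex.ofReal_one, one_smul]
        refine ⟨hlam, ?_⟩
        rw [reflection_add_one_mulVec_of_fixed hP hz hU hW hV hs hsl hfix, stateNorm_zero]
        norm_num
      · have hcard : 1 < Fintype.card V := Fintype.one_lt_card
        have hgap' := hψ.spectralGap_eq hP hE hR hcard
        have hle : lam j ≤ lam ⟨1, hcard⟩ :=
          hψ.antitone (Fin.le_def.2 (Nat.one_le_iff_ne_zero.2 hj))
        have hge := (abs_le.1 (hψ.abs_le_one hD j)).1
        have hlazy : stateNorm (discriminant (lazyChain P) ^ t *ᵥ (ψ j).ofLp) ≤ ε₂ / 4 := by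
          have h1 := aeval_mulVec_of_eigenvector (hψ.eigen j)
            ((Polynomial.C (1 / 2 : ℂ) * (1 + Polynomial.X)) ^ t)
          have h2 : Polynomial.aeval (discriminant P)
              ((Polynomial.C (1 / 2 : ℂ) * (1 + Polynomial.X)) ^ t)
              = ((1 / 2 : ℂ) • (1 + discriminant P)) ^ t := by
            rw [map_pow, map_mul, Polynomial.aeval_C, map_add, map_one, Polynomial.aeval_X,
              Algebra.smul_def]
          have h3 : ((1 / 2 : ℂ) * (1 + (lam j : ℂ))) ^ t
              = ((((1 + lam j) / 2) ^ t : ℝ) : ℂ) := by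
            push_cast
            ring
          rw [h2] at h1
          rw [discriminant_lazyChain hP.nonneg, h1, stateNorm_smul, stateNorm_orthonormalBasis,
            mul_one, Polynomial.eval_pow, Polynomial.eval_mul, Polynomial.eval_C,
            Polynomial.eval_add, Polynomial.eval_one, Polynomial.eval_X, h3, Complex.norm_real,
            Real.norm_of_nonneg (pow_nonneg (by linarith) t)]
          refine (pow_le_pow_left₀ (by linarith) ?_ t).trans hpow
          linarith
        have hnorm : stateNorm (truncatedPower t (2 ^ τ) (discriminant P) *ᵥ (ψ j).ofLp)
            ≤ ε₂ / 2 := by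
          have h1 := stateNorm_add_le
            (truncatedPower t (2 ^ τ) (discriminant P) *ᵥ (ψ j).ofLp
              - discriminant (lazyChain P) ^ t *ᵥ (ψ j).ofLp)
            (discriminant (lazyChain P) ^ t *ᵥ (ψ j).ofLp)
          rw [sub_add_cancel] at h1
          linarith [herr _ (stateNorm_orthonormalBasis ψ j)]
        rw [stateNorm_reflection_sub_one hP hz hU hW hV hs hsl]
        have h0 := stateNorm_nonneg (truncatedPower t (2 ^ τ) (discriminant P) *ᵥ (ψ j).ofLp)
        -- the norm itself is at most `ε₂ < 1`, hence so is its square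
        nlinarith
  · -- no chain has a spectral gap outside `(0, 2]`
    refine ⟨0, 0, 1, one_mem _, ?_⟩
    intro V _ _ _ G P z U enc W hP hE hR hgap hz hU hW
    have hD := stateNorm_discriminant_mulVec_le hP hz hU hW
    have hcard : 1 < Fintype.card V := Fintype.one_lt_card
    obtain ⟨ψ, lam, hψ⟩ := exists_isEigenbasis P
    have h1 := hψ.spectralGap_eq hP hE hR hcard
    have h2 := hψ.lam_one_lt hP hE hR hD hcard
    have h3 := (abs_le.1 (hψ.abs_le_one hD ⟨1, hcard⟩)).1
    exact absurd ⟨by linarith, by linarith⟩ hδ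

end
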